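/- **Setting.** Let $G=(V,E)$ be an undirected simple graph with $|V|=n$, let $\alpha\in(0,1)$ (the jump probability) and let $q$ be a probability distribution on $V$ (the jump distribution). The $\alpha$-random walk on $G$ moves, at each step, with probability $\alpha$ to a vertex drawn from $q$, and with probability $1-\alpha$ from its current vertex to a uniformly random neighbour (if the current vertex has no neighbour, it stays where it is). The PageRank vector $\pi$ of $(G,\alpha,q)$ is the unique stationary distribution of this walk. In the deletion-model the players are the vertices. A strategy of player $v$ is a nonempty subset $E_v\subseteq\Gamma(v)$ of the set $\Gamma(v)$ of neighbours of $v$ in $G$; playing it deletes every (undirected) edge $vu$ with $u\in\Gamma(v)\setminus E_v$ and leaves the rest of $G$ unchanged. The payoff of $v$ is her PageRank in the resulting graph. A strategy is improving if this PageRank is strictly larger than the PageRank of $v$ in $G$; $v$ is in best response if she has no improving strategy; and $G$ is a Nash equilibrium (for $\alpha$ and $q$) if every player is in best response. The model of computation is a real random access machine: memory consists of arrays of natural numbers and arrays of real numbers with indirect addressing, initially zero outside the input, and each memory access, assignment, addition or (truncated) subtraction of natural numbers, arithmetic operation $+,-,\times,\div$ on exact real numbers, conversion of a natural number to a real number, and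 comparison or other elementary operation takes one step. A program uses only natural-number constants, and there is no conversion from reals to integers. **Theorem 3.1.** There are a single program for this machine and a constant $C$ such that for every $n$, every tree $G$ on $n$ vertices, every $\alpha\in(0,1)$ and every probability distribution $q$ on its vertices, the program, given $n$, a list of the edges of $G$ (each edge once, in any order), $\alpha$ and $q$, halts after at most $C\,n^2$ steps and correctly answers whether $G$ is a Nash equilibrium in the deletion-model. If it is not, the program also outputs a player $v$ together with an improving strategy $E_v$ for $v$ (as a 0/1 vector). -/

import Mathlib

open scoped BigOperators

/-! ## PageRank on undirected graphs and the deletion game -/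

namespace PageRankGame

variable {V : Type*} [Fintype V]

/-- `q` is a probability distribution on the finite set `V`. -/
def IsDistribution (q : V → ℝ) : Prop :=
  (∀ v, 0 ≤ q v) ∧ ∑ v, q v = 1

open Classical in
/-- Transition probabilities of the simple random walk on `G`, where every undirected edge is
regarded as two opposite arcs: from `u` the walk moves to a uniformly random neighbour.
A vertex without neighbours (deleting edges may create one) has no arc to follow,
and there the walk stays put. -/
noncomputable def linkStep (G : SimpleGraph V) (u w : V) : ℝ :=
  if (G.neighborSet u).ncard = 0 then (if u = w then 1 else 0)
  else if G.Adj u w then 1 / ((G.neighborSet u).ncard : ℝ) else 0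

/-- Transition probabilities of the `α`-random walk: with probability `α` jump to a vertex drawn
from `q`, with probability `1 - α` follow a link. -/
noncomputable def walkStep (G : SimpleGraph V) (α : ℝ) (q : V → ℝ) (u w : V) : ℝ :=
  α * q w + (1 - α) * linkStep G u w

/-- `p` is a stationary distribution of the `α`-random walk on `G`. -/
def IsStationary (G : SimpleGraph V) (α : ℝ) (q : V → ℝ) (p : V → ℝ) : Prop :=
  IsDistribution p ∧ ∀ w, ∑ u, p u * walkStep G α q u w = p w

theorem linkStep_nonneg {W : Type*} (G : SimpleGraph W) (u w : W) : 0 ≤ linkStep G u w := by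
  unfold linkStep
  split_ifs <;> positivity

theorem linkStep_sum (G : SimpleGraph V) (u : V) : ∑ w, linkStep G u w = 1 := by
  classical
  unfold linkStep
  by_cases h : (G.neighborSet u).ncard = 0
  · simp [h]
  · simp only [h, if_false]
    rw [← Finset.sum_filter, Finset.sum_const, nsmul_eq_mul]
    have : (Finset.univ.filter (G.Adj u)).card = (G.neighborSet u).ncard := by
      rw [← Set.ncard_coe_finset]
      congr 1
      ext x
      simp
    rw [this]
    field_simp

theorem stationary_iff (G : SimpleGraph V) (α : ℝ) (q p : V → ℝ) (hp : ∑ v, p v = 1) (w : V) :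
    ∑ u, p u * walkStep G α q u w = p w ↔
      p w = α * q w + (1 - α) * ∑ u, p u * linkStep G u w := by
  have : ∑ u, p u * walkStep G α q u w = α * q w + (1 - α) * ∑ u, p u * linkStep G u w := by
    have h : ∀ u, p u * walkStep G α q u w
        = p u * (α * q w) + (1 - α) * (p u * linkStep G u w) := by
      intro u; unfold walkStep; ring
    simp only [h]
    rw [Finset.sum_add_distrib, ← Finset.sum_mul, hp, ← Finset.mul_sum, one_mul]
  rw [this, eq_comm]

/-- The fixed-point inequality behind both uniqueness and positivity. -/
theorem eq_zero_of_le_step (G : SimpleGraph V) (α : ℝ) (h0 : 0 < α) (y : V → ℝ)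
    (hy : ∀ v, 0 ≤ y v) (h : ∀ w, y w ≤ (1 - α) * ∑ u, y u * linkStep G u w) (v : V) :
    y v = 0 := by
  have h1 : ∑ w, y w ≤ (1 - α) * ∑ u, y u := by
    calc ∑ w, y w ≤ ∑ w, (1 - α) * ∑ u, y u * linkStep G u w := Finset.sum_le_sum fun w _ => h w
      _ = (1 - α) * ∑ u, y u := by
        rw [← Finset.mul_sum, Finset.sum_comm]
        congr 1
        refine Finset.sum_congr rfl fun u _ => ?_
        rw [← Finset.mul_sum, linkStep_sum, mul_one]
  have h2 : 0 ≤ ∑ w, y w := Finset.sum_nonneg fun w _ => hy w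
  have h3 : ∑ w, y w = 0 := by nlinarith
  exact (Finset.sum_eq_zero_iff_of_nonneg fun w _ => hy w).1 h3 v (Finset.mem_univ v)

theorem fixed_eq_zero (G : SimpleGraph V) (α : ℝ) (h0 : 0 < α) (h1 : α < 1) (d : V → ℝ)
    (h : ∀ w, d w = (1 - α) * ∑ u, d u * linkStep G u w) : d = 0 := by
  funext v
  have := eq_zero_of_le_step G α h0 (fun v => |d v|) (fun v => abs_nonneg _) (fun w => by
    conv_lhs => rw [h w]
    rw [abs_mul, abs_of_pos (by linarith : 0 < 1 - α)]
    refine mul_le_mul_of_nonneg_left ?_ (by linarith)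
    refine (Finset.abs_sum_le_sum_abs _ _).trans (Finset.sum_le_sum fun u _ => ?_)
    rw [abs_mul, abs_of_nonneg (linkStep_nonneg G u w)]) v
  simpa using this

/-- The `α`-random walk has exactly one stationary distribution. -/
theorem existsUnique_stationary (G : SimpleGraph V) (α : ℝ) (q : V → ℝ) (h0 : 0 < α)
    (h1 : α < 1) (hq : IsDistribution q) : ∃! p, IsStationary G α q p := by
  classical
  let T : (V → ℝ) →ₗ[ℝ] (V → ℝ) :=
    { toFun := fun d w => d w - (1 - α) * ∑ u, d u * linkStep G u w
      map_add' := by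
        intro x y; funext w
        simp only [Pi.add_apply, add_mul, Finset.sum_add_distrib]; ring
      map_smul' := by
        intro c x; funext w
        simp only [Pi.smul_apply, smul_eq_mul, RingHom.id_apply, mul_assoc, ← Finset.mul_sum]
        ring }
  have hinj : Function.Injective T := by
    rw [← LinearMap.ker_eq_bot, LinearMap.ker_eq_bot']
    intro d hd
    refine fixed_eq_zero G α h0 h1 d fun w => ?_
    have : d w - (1 - α) * ∑ u, d u * linkStep G u w = 0 := congrFun hd w
    linarith
  obtain ⟨p, hp⟩ := (LinearMap.injective_iff_surjective.1 hinj) (fun w => α * q w)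
  have hp' : ∀ w, p w = α * q w + (1 - α) * ∑ u, p u * linkStep G u w := by
    intro w
    have : p w - (1 - α) * ∑ u, p u * linkStep G u w = α * q w := congrFun hp w
    linarith
  have hnn : ∀ v, 0 ≤ p v := by
    intro v
    have := eq_zero_of_le_step G α h0 (fun v => max (-(p v)) 0) (fun v => le_max_right _ _)
      (fun w => by
        refine max_le ?_ ?_
        · rw [hp' w]
          have hs : -∑ u, p u * linkStep G u w ≤ ∑ u, max (-(p u)) 0 * linkStep G u w := by
            rw [← Finset.sum_neg_distrib]
            refine Finset.sum_le_sum fun u _ => ?_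
            rw [← neg_mul]
            exact mul_le_mul_of_nonneg_right (le_max_left _ _) (linkStep_nonneg G u w)
          have := mul_le_mul_of_nonneg_left hs (by linarith : 0 ≤ 1 - α)
          have hqw := mul_nonneg h0.le (hq.1 w)
          linarith
        · refine mul_nonneg (by linarith) (Finset.sum_nonneg fun u _ => ?_)
          exact mul_nonneg (le_max_right _ _) (linkStep_nonneg G u w)) v
    have h2 := le_max_left (-(p v)) 0
    have h3 : max (-(p v)) 0 = 0 := this
    linarith
  have hsum : ∑ v, p v = 1 := by
    have : ∑ w, p w = α * ∑ w, q w + (1 - α) * ∑ u, p u := by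
      calc ∑ w, p w = ∑ w, (α * q w + (1 - α) * ∑ u, p u * linkStep G u w) :=
            Finset.sum_congr rfl fun w _ => hp' w
        _ = _ := by
          rw [Finset.sum_add_distrib, ← Finset.mul_sum, ← Finset.mul_sum, Finset.sum_comm]
          congr 2
          refine Finset.sum_congr rfl fun u _ => ?_
          rw [← Finset.mul_sum, linkStep_sum, mul_one]
    rw [hq.2] at this
    nlinarith
  refine ⟨p, ⟨⟨hnn, hsum⟩, fun w => (stationary_iff G α q p hsum w).2 (hp' w)⟩, ?_⟩
  rintro p' ⟨⟨_, hsum'⟩, hst⟩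
  have := fixed_eq_zero G α h0 h1 (p' - p) (fun w => by
    have e1 := (stationary_iff G α q p' hsum' w).1 (hst w)
    have e2 := hp' w
    simp only [Pi.sub_apply, sub_mul, Finset.sum_sub_distrib]
    linarith)
  exact sub_eq_zero.1 this

/-- The PageRank vector: the stationary distribution of the `α`-random walk on `G`. -/
noncomputable def pageRank (G : SimpleGraph V) (α : ℝ) (q : V → ℝ) : V → ℝ :=
  Classical.epsilon (IsStationary G α q)

theorem pageRank_isStationary (G : SimpleGraph V) (α : ℝ) (q : V → ℝ) (h0 : 0 < α)
    (h1 : α < 1) (hq : IsDistribution q) : IsStationary G α q (pageRank G α q) :=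
  Classical.epsilon_spec (existsUnique_stationary G α q h0 h1 hq).exists

/-- The graph after player `v` retains exactly the neighbours in `E` and deletes her edges to all
her other neighbours. -/
def retain (G : SimpleGraph V) (v : V) (E : Set V) : SimpleGraph V :=
  G.deleteEdges ((fun u => s(v, u)) '' (G.neighborSet v \ E))

/-- A strategy of player `v` in the deletion-model: a nonempty set of retained neighbours. -/
def IsStrategy (G : SimpleGraph V) (v : V) (E : Set V) : Prop :=
  E ⊆ G.neighborSet v ∧ E.Nonempty

/-- Retaining exactly `E` strictly increases the PageRank of `v`. -/
def IsImproving (G : SimpleGraph V) (α : ℝ) (q : V → ℝ) (v : V) (E : Set V) : Prop :=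
  IsStrategy G v E ∧ pageRank G α q v < pageRank (retain G v E) α q v

/-- `v` cannot increase her PageRank by deleting some of her edges. -/
def IsBestResponse (G : SimpleGraph V) (α : ℝ) (q : V → ℝ) (v : V) : Prop :=
  ∀ E : Set V, IsStrategy G v E → pageRank (retain G v E) α q v ≤ pageRank G α q v

/-- Every player is in best response. -/
def IsNash (G : SimpleGraph V) (α : ℝ) (q : V → ℝ) : Prop :=
  ∀ v, IsBestResponse G α q v

end PageRankGame

/-! ## A real random access machine with unit-cost operations

The memory consists of arrays of natural numbers and arrays of real numbers. Arrays are
addressed indirectly. A program is a finite text: it names finitely many arrays, and its only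
numerical constants are natural number literals. Every elementary operation (loading a constant,
a memory access, an arithmetic operation on naturals or on reals, a comparison, an assignment)
costs one step. Natural numbers can only be added and subtracted; there is no rounding or other
way to turn a real number into an integer. -/

namespace RealRAM

/-- Memory contents: entry `i` of the integer array `a` is `ints a i`, entry `i` of the real
array `a` is `reals a i`. -/
structure Store where
  ints : ℕ → ℕ → ℕ
  reals : ℕ → ℕ → ℝ

/-- Integer expressions. -/
inductive NExpr where
  | const (k : ℕ)
  | get (a : ℕ) (i : NExpr)
  | add (e f : NExpr)
  | sub (e f : NExpr)

/-- Subtraction is truncated at zero. -/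
def NExpr.eval (s : Store) : NExpr → ℕ
  | const k => k
  | get a i => s.ints a (i.eval s)
  | add e f => e.eval s + f.eval s
  | sub e f => e.eval s - f.eval s

def NExpr.cost : NExpr → ℕ
  | const _ => 1
  | get _ i => i.cost + 1
  | add e f => e.cost + f.cost + 1
  | sub e f => e.cost + f.cost + 1

/-- Real expressions. -/
inductive RExpr where
  | ofNat (e : NExpr)
  | get (a : ℕ) (i : NExpr)
  | add (e f : RExpr)
  | sub (e f : RExpr)
  | mul (e f : RExpr)
  | div (e f : RExpr)

/-- Division by zero returns zero; this adds no power, since zero can be recognised by a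
comparison. -/
noncomputable def RExpr.eval (s : Store) : RExpr → ℝ
  | ofNat e => (e.eval s : ℝ)
  | get a i => s.reals a (i.eval s)
  | add e f => e.eval s + f.eval s
  | sub e f => e.eval s - f.eval s
  | mul e f => e.eval s * f.eval s
  | div e f => e.eval s / f.eval s

def RExpr.cost : RExpr → ℕ
  | ofNat e => e.cost + 1
  | get _ i => i.cost + 1
  | add e f => e.cost + f.cost + 1
  | sub e f => e.cost + f.cost + 1
  | mul e f => e.cost + f.cost + 1
  | div e f => e.cost + f.cost + 1

/-- Tests on which control flow can branch. -/
inductive Cond where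
  | natLt (e f : NExpr)
  | natEq (e f : NExpr)
  | realLt (e f : RExpr)
  | neg (b : Cond)
  | and (b c : Cond)

def Cond.Holds (s : Store) : Cond → Prop
  | natLt e f => e.eval s < f.eval s
  | natEq e f => e.eval s = f.eval s
  | realLt e f => e.eval s < f.eval s
  | neg b => ¬ b.Holds s
  | and b c => b.Holds s ∧ c.Holds s

def Cond.cost : Cond → ℕ
  | natLt e f => e.cost + f.cost + 1
  | natEq e f => e.cost + f.cost + 1
  | realLt e f => e.cost + f.cost + 1
  | neg b => b.cost + 1
  | and b c => b.cost + c.cost + 1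

/-- Programs: assignments to an array entry, sequencing, branching and while-loops. -/
inductive Prog where
  | skip
  | setInt (a : ℕ) (i e : NExpr)
  | setReal (a : ℕ) (i : NExpr) (e : RExpr)
  | seq (p r : Prog)
  | branch (b : Cond) (p r : Prog)
  | loop (b : Cond) (p : Prog)

def Store.setInt (s : Store) (a i x : ℕ) : Store :=
  { s with ints := Function.update s.ints a (Function.update (s.ints a) i x) }

noncomputable def Store.setReal (s : Store) (a i : ℕ) (x : ℝ) : Store :=
  { s with reals := Function.update s.reals a (Function.update (s.reals a) i x) }

/-- `Exec p s t s'`: started in memory `s`, the program `p` halts after exactly `t` steps,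
with memory `s'`. -/
inductive Exec : Prog → Store → ℕ → Store → Prop where
  | skip (s : Store) : Exec .skip s 1 s
  | setInt (s : Store) (a : ℕ) (i e : NExpr) :
      Exec (.setInt a i e) s (i.cost + e.cost + 1) (s.setInt a (i.eval s) (e.eval s))
  | setReal (s : Store) (a : ℕ) (i : NExpr) (e : RExpr) :
      Exec (.setReal a i e) s (i.cost + e.cost + 1) (s.setReal a (i.eval s) (e.eval s))
  | seq {p r : Prog} {s s₁ s₂ : Store} {t₁ t₂ : ℕ} :
      Exec p s t₁ s₁ → Exec r s₁ t₂ s₂ → Exec (.seq p r) s (t₁ + t₂) s₂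
  | branchTrue {b : Cond} {p r : Prog} {s s₁ : Store} {t : ℕ} :
      b.Holds s → Exec p s t s₁ → Exec (.branch b p r) s (b.cost + t) s₁
  | branchFalse {b : Cond} {p r : Prog} {s s₁ : Store} {t : ℕ} :
      ¬ b.Holds s → Exec r s t s₁ → Exec (.branch b p r) s (b.cost + t) s₁
  | loopTrue {b : Cond} {p : Prog} {s s₁ s₂ : Store} {t₁ t₂ : ℕ} :
      b.Holds s → Exec p s t₁ s₁ → Exec (.loop b p) s₁ t₂ s₂ →
        Exec (.loop b p) s (b.cost + t₁ + t₂) s₂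
  | loopFalse {b : Cond} {p : Prog} {s : Store} :
      ¬ b.Holds s → Exec (.loop b p) s b.cost s

/-- Programs are deterministic: running time and final memory are determined by the input. -/
theorem Exec.deterministic {p : Prog} {s s₁ s₂ : Store} {t₁ t₂ : ℕ}
    (h₁ : Exec p s t₁ s₁) (h₂ : Exec p s t₂ s₂) : t₁ = t₂ ∧ s₁ = s₂ := by
  induction h₁ generalizing t₂ s₂ with
  | skip s => cases h₂; exact ⟨rfl, rfl⟩
  | setInt s a i e => cases h₂; exact ⟨rfl, rfl⟩
  | setReal s a i e => cases h₂; exact ⟨rfl, rfl⟩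
  | seq _ _ ih ih' =>
    cases h₂ with
    | seq a b =>
      obtain ⟨rfl, rfl⟩ := ih a
      obtain ⟨rfl, rfl⟩ := ih' b
      exact ⟨rfl, rfl⟩
  | branchTrue hb _ ih =>
    cases h₂ with
    | branchTrue _ a => obtain ⟨rfl, rfl⟩ := ih a; exact ⟨rfl, rfl⟩
    | branchFalse hn _ => exact absurd hb hn
  | branchFalse hb _ ih =>
    cases h₂ with
    | branchTrue hn _ => exact absurd hn hb
    | branchFalse _ a => obtain ⟨rfl, rfl⟩ := ih a; exact ⟨rfl, rfl⟩
  | loopTrue hb _ _ ih ih' =>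
    cases h₂ with
    | loopTrue _ a b =>
      obtain ⟨rfl, rfl⟩ := ih a
      obtain ⟨rfl, rfl⟩ := ih' b
      exact ⟨rfl, rfl⟩
    | loopFalse hn => exact absurd hb hn
  | loopFalse hb =>
    cases h₂ with
    | loopTrue hn _ _ => exact absurd hn hb
    | loopFalse _ => exact ⟨rfl, rfl⟩

end RealRAM

/-! ## Input and output of the decision problem -/

namespace PageRankGame

/-- `es` lists every edge of `G` exactly once, in any order and with arbitrary orientations. -/
def IsEdgeList {n : ℕ} (G : SimpleGraph (Fin n)) (es : List (Fin n × Fin n)) : Prop :=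
  (es.map fun e => s(e.1, e.2)).Nodup ∧ ∀ x, x ∈ (es.map fun e => s(e.1, e.2)) ↔ x ∈ G.edgeSet

/-- Initial memory. Integer array `0` holds the number of vertices and the number of edges,
integer arrays `1` and `2` hold the two endpoints of the listed edges, real array `0` holds `α`
and real array `1` holds `q`. Everything else is zero. -/
noncomputable def inputStore {n : ℕ} (es : List (Fin n × Fin n)) (α : ℝ) (q : Fin n → ℝ) :
    RealRAM.Store where
  ints a i :=
    if a = 0 then (if i = 0 then n else if i = 1 then es.length else 0)
    else if a = 1 then ((es[i]?).map fun e => (e.1 : ℕ)).getD 0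
    else if a = 2 then ((es[i]?).map fun e => (e.2 : ℕ)).getD 0
    else 0
  reals a i :=
    if a = 0 then (if i = 0 then α else 0)
    else if a = 1 then (if h : i < n then q ⟨i, h⟩ else 0)
    else 0

/-- The yes/no answer: entry `0` of integer array `3` (one for yes, zero for no). -/
def answer (s : RealRAM.Store) : ℕ := s.ints 3 0

/-- The player whose strategy is output: entry `1` of integer array `3`. -/
def outPlayer (s : RealRAM.Store) : ℕ := s.ints 3 1

/-- The strategy that is output: the vertices whose entry in the 0/1 vector in integer array `4`
is one. -/
def outStrategy (n : ℕ) (s : RealRAM.Store) : Set (Fin n) := {u | s.ints 4 u = 1}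

end PageRankGame

/-! Write `c = 1 - α`. In a tree, the part behind an arc `w → v` is attached to `v` only through
that arc, so it does not notice which other edges `v` deletes. By induction along the tree, the flow
along an arc `x → w` (the amount `c * p x / deg x`) is an affine function of the flow along `w → x`.
Its coefficients, the messages `a x w` and `b x w`, are given by a recursion in the original tree
and stay valid after any deletion by a `v` that is not behind the arc (`flow_eq`). Stationarity at
`v` then gives the payoff of a strategy `E` with `k` elements as `k (α q v + ∑ a w v) / (k - c ∑ b w
v)`, summed over `w ∈ E` (`pageRank_retain`).

To improve, this quotient has to exceed the present PageRank `π` of `v`. Clearing the positive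
denominator, `E` is improving iff `∑ (k * a w v + π * c * b w v) > k * (π - α * q v)`
(`isImproving_iff`). For fixed `k` the right-hand side is constant and the left-hand side is a sum
of independent contributions, so only the `k` neighbours with the largest contributions need testing
(`sum_le_sum_range_of_bijOn`, `does_testBest`).

Two arguments keep the time quadratic. Messages are found by `n` passes over all arcs. Sums of
messages by target are maintained, which makes one update constant time, and each pass makes
messages of one further height correct (`does_passStep`, `does_passMessages`). For a player of
degree `d` the sorting for `k = 1, ..., d` is amortised: contributions are affine in `k` with slope
`a w v`, so once the list is sorted for `k`, a pair out of order for `k + 1` is also out of order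
with respect to `a`. Hence every exchange after the first round removes an inversion with respect to
`a`, of which there are at most `d * d` (`exists_exec_gnomeSort`, `does_rounds`). A player costs
`O(d ^ 2 + n)`, and the squared degrees sum to at most `n` times the number of arcs, which is `O(n ^
2)`. -/

namespace PageRankGame

/-! ### Branches of a tree -/

section Branch

variable {V : Type*}

/-- The vertices that stay connected to `x` when the edge `xw` is removed. -/
def branch (G : SimpleGraph V) (x w : V) : Set V :=
  {u | (G.deleteEdges {s(x, w)}).Reachable x u}

theorem self_mem_branch (G : SimpleGraph V) (x w : V) : x ∈ branch G x w :=
  SimpleGraph.Reachable.refl x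

theorem notMem_branch {G : SimpleGraph V} (hG : G.IsAcyclic) {x w : V} (h : G.Adj x w) :
    w ∉ branch G x w := by
  have := SimpleGraph.isAcyclic_iff_forall_adj_isBridge.1 hG h
  rw [SimpleGraph.isBridge_iff] at this
  exact this

/-- A walk from `y` avoiding the edge `yx` never meets `x`, since `yx` is a bridge. It therefore
cannot use the edge `xw`. -/
theorem branch_subset {G : SimpleGraph V} (hG : G.IsAcyclic) {x w y : V} (h : G.Adj x w)
    (hy : G.Adj y x) (hne : y ≠ w) : branch G y x ⊆ branch G x w := by
  have key : ∀ (u z : V) (p : (G.deleteEdges {s(y, x)}).Walk u z),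
      u ∈ branch G y x → u ∈ branch G x w → z ∈ branch G x w := by
    intro u z p
    induction p with
    | nil => exact fun _ h => h
    | @cons u u' z hadj p ih =>
      intro h1 h2
      have h3 : u' ∈ branch G y x := SimpleGraph.Reachable.trans h1 hadj.reachable
      refine ih h3 (SimpleGraph.Reachable.trans h2 (SimpleGraph.Adj.reachable ?_))
      rw [SimpleGraph.deleteEdges_adj] at hadj ⊢
      refine ⟨hadj.1, fun hh => ?_⟩
      rw [Set.mem_singleton_iff, Sym2.eq_iff] at hh
      rcases hh with ⟨rfl, _⟩ | ⟨_, rfl⟩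
      · exact notMem_branch hG hy h1
      · exact notMem_branch hG hy h3
  intro z hz
  obtain ⟨p⟩ := hz
  refine key y z p (self_mem_branch G y x) (SimpleGraph.Adj.reachable ?_)
  rw [SimpleGraph.deleteEdges_adj]
  refine ⟨hy.symm, fun hh => ?_⟩
  rw [Set.mem_singleton_iff, Sym2.eq_iff] at hh
  rcases hh with ⟨_, h'⟩ | ⟨rfl, _⟩
  · exact hne h'
  · exact h.ne rfl

/-- The number of vertices behind the arc from `x` to `w`. -/
noncomputable def height (G : SimpleGraph V) (x w : V) : ℕ := (branch G x w).ncard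

variable [Fintype V]

/-- The inclusion of branches is strict because `x` lies only in the larger one. This is the measure
for all inductions along arcs. -/
theorem height_lt_height {G : SimpleGraph V} (hG : G.IsAcyclic) {x w y : V} (h : G.Adj x w)
    (hy : G.Adj y x) (hne : y ≠ w) : height G y x < height G x w :=
  Set.ncard_lt_ncard ⟨branch_subset hG h hy hne,
    fun hs => notMem_branch hG hy (hs (self_mem_branch G x w))⟩ (Set.toFinite _)

theorem height_lt_card {G : SimpleGraph V} (hG : G.IsAcyclic) {x w : V} (h : G.Adj x w) :
    height G x w < Fintype.card V := by
  rw [← Nat.card_eq_fintype_card, ← Set.ncard_univ]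
  exact Set.ncard_lt_ncard ⟨Set.subset_univ _, fun hs => notMem_branch hG h (hs trivial)⟩
    (Set.toFinite _)

end Branch

/-! ### Retaining some of the edges of a vertex -/

variable {V : Type*} [Fintype V]

open Classical in
/-- The neighbours of a vertex as a finite set. -/
noncomputable def nbrs (G : SimpleGraph V) (x : V) : Finset V := Finset.univ.filter (G.Adj x)

@[simp] theorem mem_nbrs {G : SimpleGraph V} {x y : V} : y ∈ nbrs G x ↔ G.Adj x y := by
  simp [nbrs]

theorem ncard_neighborSet (G : SimpleGraph V) (x : V) :
    (G.neighborSet x).ncard = (nbrs G x).card := by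
  rw [← Set.ncard_coe_finset]
  congr 1
  ext y
  simp

theorem retain_adj {V : Type*} {G : SimpleGraph V} {v : V} {E : Set V} {x y : V} :
    (retain G v E).Adj x y ↔ G.Adj x y ∧ (x = v → y ∈ E) ∧ (y = v → x ∈ E) := by
  rw [retain, SimpleGraph.deleteEdges_adj]
  refine and_congr_right fun h => ?_
  constructor
  · intro hn
    refine ⟨?_, ?_⟩
    · rintro rfl
      by_contra hy
      exact hn ⟨y, ⟨h, hy⟩, rfl⟩
    · rintro rfl
      by_contra hx
      exact hn ⟨x, ⟨h.symm, hx⟩, Sym2.eq_swap⟩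
  · rintro ⟨h1, h2⟩ ⟨u, ⟨_, hu⟩, he⟩
    rcases Sym2.eq_iff.1 he with ⟨rfl, rfl⟩ | ⟨rfl, rfl⟩
    · exact hu (h1 rfl)
    · exact hu (h2 rfl)

theorem retain_neighborSet {V : Type*} (G : SimpleGraph V) (v : V) :
    retain G v (G.neighborSet v) = G := by
  ext x y
  rw [retain_adj]
  refine ⟨fun h => h.1, fun h => ⟨h, ?_, ?_⟩⟩
  · rintro rfl; exact h
  · rintro rfl; exact h.symm

theorem nbrs_retain_self {G : SimpleGraph V} {v : V} {E : Finset V} (hE : E ⊆ nbrs G v) :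
    nbrs (retain G v E) v = E := by
  ext y
  rw [mem_nbrs, retain_adj]
  refine ⟨fun h => h.2.1 rfl, fun h => ⟨mem_nbrs.1 (hE h), fun _ => h, ?_⟩⟩
  rintro rfl
  exact h

/-- The hypothesis on `w` excludes the loop with which an isolated vertex feeds itself. Isolated
vertices elsewhere, which a deletion may create, send nothing to `w`. -/
theorem stationary_eq_sum_nbrs {H : SimpleGraph V} {α : ℝ} {q p : V → ℝ}
    (hp : IsStationary H α q p) {w : V} (hw : (nbrs H w).Nonempty) :
    p w = α * q w + ∑ u ∈ nbrs H w, (1 - α) * p u / (nbrs H u).card := by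
  rw [(stationary_iff H α q p hp.1.2 w).1 (hp.2 w), Finset.mul_sum]
  congr 1
  rw [← Finset.sum_subset (Finset.subset_univ (nbrs H w))]
  · refine Finset.sum_congr rfl fun u hu => ?_
    rw [mem_nbrs] at hu
    have : (nbrs H u).card ≠ 0 := (Finset.card_pos.2 ⟨w, mem_nbrs.2 hu.symm⟩).ne'
    rw [linkStep, ncard_neighborSet, if_neg this, if_pos hu.symm]
    ring
  · intro u _ hu
    rw [mem_nbrs] at hu
    rw [linkStep, ncard_neighborSet]
    split_ifs with h1 h2 h3
    · subst h2
      exact absurd (Finset.card_eq_zero.1 h1) hw.ne_empty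
    · simp
    · exact absurd h3.symm hu
    · simp

/-! ### Messages -/

variable [DecidableEq V]

/-- `b x w` is the probability of ever following the link from `x` towards `w`, started in `x`,
without jumping and `a x w` the weight of all starting vertices behind `x` with respect to `f`. -/
structure IsMessage (G : SimpleGraph V) (c : ℝ) (f : V → ℝ) (a b : V → V → ℝ) : Prop where
  b_eq : ∀ x w, G.Adj x w → b x w = c / ((nbrs G x).card - c * ∑ y ∈ (nbrs G x).erase w, b y x)
  a_eq : ∀ x w, G.Adj x w → a x w = b x w * (f x + ∑ y ∈ (nbrs G x).erase w, a y x)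

/-- Every local recursion along the arcs of a tree has a solution. -/
theorem exists_arc_recursion {G : SimpleGraph V} (hG : G.IsAcyclic) {R : Type*} [Inhabited R]
    (F : (x w : V) → (V → R) → R)
    (hF : ∀ x w g g', (∀ y ∈ (nbrs G x).erase w, g y = g' y) → F x w g = F x w g') :
    ∃ b : V → V → R, ∀ x w, G.Adj x w → b x w = F x w (fun y => b y x) := by
  -- The recursion is iterated from an arbitrary start. After `r` rounds the values on arcs of
  -- height less than `r` no longer change, and all heights are below the number of vertices.
  let B : ℕ → V → V → R := fun r => Nat.rec (fun _ _ => default)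
    (fun _ B x w => F x w fun y => B y x) r
  have hB : ∀ r, ∀ x w, G.Adj x w → height G x w < r → B (r + 1) x w = B r x w := by
    intro r
    induction r with
    | zero => intro x w _ h; omega
    | succ r ih =>
      intro x w hxw h
      refine hF x w _ _ fun y hy => ?_
      rw [Finset.mem_erase, mem_nbrs] at hy
      have := height_lt_height hG hxw hy.2.symm hy.1
      exact ih y x hy.2.symm (by omega)
  refine ⟨B (Fintype.card V), fun x w h => ?_⟩
  exact (hB _ x w h (height_lt_card hG h)).symm

theorem exists_isMessage {G : SimpleGraph V} (hG : G.IsAcyclic) (c : ℝ) (f : V → ℝ) :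
    ∃ a b, IsMessage G c f a b := by
  obtain ⟨b, hb⟩ := exists_arc_recursion hG
    (fun x w g => c / ((nbrs G x).card - c * ∑ y ∈ (nbrs G x).erase w, g y)) (by
      intro x w g g' h
      simp only [Finset.sum_congr rfl h])
  obtain ⟨a, ha⟩ := exists_arc_recursion hG
    (fun x w g => b x w * (f x + ∑ y ∈ (nbrs G x).erase w, g y)) (by
      intro x w g g' h
      simp only [Finset.sum_congr rfl h])
  exact ⟨a, b, hb, ha⟩

/-! ### Bounds on the messages. -/

section Bounds

variable {G : SimpleGraph V} {c : ℝ} {f : V → ℝ} {a b : V → V → ℝ}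

/-- The sum has one term fewer than `s` has elements, and all terms are below one. Thus every
denominator in the recursion for `b` is at least one. -/
theorem one_le_card_sub {ι : Type*} [DecidableEq ι] {s : Finset ι} {g : ι → ℝ} {w : ι}
    (hw : w ∈ s) (h1 : c < 1)
    (hg : ∀ y ∈ s.erase w, 0 < g y ∧ g y < 1) : 1 ≤ s.card - c * ∑ y ∈ s.erase w, g y := by
  have hs : ∑ y ∈ s.erase w, g y ≤ s.card - 1 := by
    calc ∑ y ∈ s.erase w, g y ≤ ∑ y ∈ s.erase w, (1 : ℝ) :=
          Finset.sum_le_sum fun y hy => (hg y hy).2.le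
      _ = s.card - 1 := by
        rw [Finset.sum_const, nsmul_one, Finset.card_erase_of_mem hw,
          Nat.cast_sub (Finset.card_pos.2 ⟨w, hw⟩), Nat.cast_one]
  have hs' : 0 ≤ ∑ y ∈ s.erase w, g y := Finset.sum_nonneg fun y hy => (hg y hy).1.le
  nlinarith

theorem IsMessage.bounds (hG : G.IsAcyclic) (h0 : 0 < c) (h1 : c < 1)
    (h : IsMessage G c f a b) {x w : V} (hxw : G.Adj x w) : 0 < b x w ∧ b x w < 1 := by
  induction hr : height G x w using Nat.strong_induction_on generalizing x w with
  | _ r ih =>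
    have := one_le_card_sub (s := nbrs G x) (g := fun y => b y x) (w := w) (c := c) (by simpa)
      h1 (fun y hy => by
        rw [Finset.mem_erase, mem_nbrs] at hy
        exact ih _ (hr ▸ height_lt_height hG hxw hy.2.symm hy.1) hy.2.symm rfl)
    rw [h.b_eq x w hxw]
    refine ⟨by positivity, (div_lt_one (by linarith)).2 (by linarith)⟩

theorem IsMessage.one_le (hG : G.IsAcyclic) (h0 : 0 < c) (h1 : c < 1)
    (h : IsMessage G c f a b) {x w : V} (hxw : G.Adj x w) :
    1 ≤ (nbrs G x).card - c * ∑ y ∈ (nbrs G x).erase w, b y x :=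
  one_le_card_sub (by simpa) h1 fun y hy => by
    rw [Finset.mem_erase, mem_nbrs] at hy
    exact h.bounds hG h0 h1 hy.2.symm

end Bounds

/-! ### The payoff of a strategy -/

section Payoff

variable {G : SimpleGraph V} {α : ℝ} {q : V → ℝ} {a b : V → V → ℝ}

/-- The flow along an arc in terms of the messages and the flow along the opposite arc. -/
theorem flow_eq (hG : G.IsAcyclic) (h0 : 0 < α) (h1 : α < 1)
    (hm : IsMessage G (1 - α) (fun v => α * q v) a b) {v : V} {E : Set V} {p : V → ℝ}
    (hp : IsStationary (retain G v E) α q p) {x w : V} (hxw : (retain G v E).Adj x w)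
    (hv : v ∉ branch G x w) :
    (1 - α) * p x / (nbrs (retain G v E) x).card =
      a x w + b x w * ((1 - α) * p w / (nbrs (retain G v E) w).card) := by
  induction hr : height G x w using Nat.strong_induction_on generalizing x w with
  | _ r ih =>
    have hxw' : G.Adj x w := (retain_adj.1 hxw).1
    have hxv : x ≠ v := by rintro rfl; exact hv (self_mem_branch G x w)
    -- Neither `x` nor a neighbour of `x` other than `w` is `v`, as these vertices lie behind the
    -- arc. So `x` has lost no edge.
    have hN : nbrs (retain G v E) x = nbrs G x := by
      ext y
      rw [mem_nbrs, mem_nbrs]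
      refine ⟨fun h => (retain_adj.1 h).1, fun h => ?_⟩
      by_cases hyw : y = w
      · rwa [hyw]
      · refine retain_adj.2 ⟨h, fun hh => absurd hh hxv, ?_⟩
        rintro rfl
        exact absurd (branch_subset hG hxw' h.symm hyw (self_mem_branch G y x)) hv
    have hst := stationary_eq_sum_nbrs hp (w := x) ⟨w, mem_nbrs.2 hxw⟩
    rw [hN] at hst ⊢
    have hwx : w ∈ nbrs G x := mem_nbrs.2 hxw'
    rw [← Finset.add_sum_erase _ _ hwx] at hst
    have hsum : ∑ y ∈ (nbrs G x).erase w, (1 - α) * p y / (nbrs (retain G v E) y).card =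
        ∑ y ∈ (nbrs G x).erase w, (a y x + b y x * ((1 - α) * p x / (nbrs G x).card)) := by
      refine Finset.sum_congr rfl fun y hy => ?_
      rw [Finset.mem_erase, mem_nbrs] at hy
      have hyx : (retain G v E).Adj y x := by
        rw [SimpleGraph.adj_comm, ← mem_nbrs, hN, mem_nbrs]
        exact hy.2
      rw [← hN]
      exact ih _ (hr ▸ height_lt_height hG hxw' hy.2.symm hy.1) hyx
        (fun h => hv (branch_subset hG hxw' hy.2.symm hy.1 h)) rfl
    rw [hsum, Finset.sum_add_distrib, ← Finset.sum_mul] at hst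
    have hpos := hm.one_le hG (by linarith) (by linarith) hxw'
    have hd : (0 : ℝ) < (nbrs G x).card := by
      exact_mod_cast Finset.card_pos.2 ⟨w, hwx⟩
    rw [hm.a_eq x w hxw', hm.b_eq x w hxw']
    generalize (1 - α) * p w / ((nbrs (retain G v E) w).card : ℝ) = φ at *
    generalize ∑ y ∈ (nbrs G x).erase w, a y x = A at *
    generalize ∑ y ∈ (nbrs G x).erase w, b y x = B at *
    generalize ((nbrs G x).card : ℝ) = d at *
    -- After inserting the induction hypothesis, stationarity at `x` is a linear equation for `p x`.
    -- Solving it reproduces the recursion for the messages.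
    have hne : d - (1 - α) * B ≠ 0 := by linarith
    have : p x * (d - (1 - α) * B) = d * (α * q x + A + φ) := by
      have h2 : p x * d = (α * q x + (φ + (A + B * ((1 - α) * p x / d)))) * d := by rw [← hst]
      have h3 : B * ((1 - α) * p x / d) * d = B * ((1 - α) * p x) := by field_simp
      linear_combination h2 + h3
    field_simp
    linear_combination (1 - α) * this

/-- The payoff equation of the strategy `E`. -/
theorem pageRank_retain (hG : G.IsAcyclic) (h0 : 0 < α) (h1 : α < 1) (hq : IsDistribution q)
    (hm : IsMessage G (1 - α) (fun v => α * q v) a b) {v : V} {E : Finset V}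
    (hE : E ⊆ nbrs G v) (hne : E.Nonempty) :
    pageRank (retain G v E) α q v * (E.card - (1 - α) * ∑ w ∈ E, b w v) =
      E.card * (α * q v + ∑ w ∈ E, a w v) := by
  have hp := pageRank_isStationary (retain G v E) α q h0 h1 hq
  have hst := stationary_eq_sum_nbrs hp (w := v) (by rwa [nbrs_retain_self hE])
  generalize pageRank (retain G v E) α q = p at *
  rw [nbrs_retain_self hE] at hst
  have hsum : ∑ u ∈ E, (1 - α) * p u / (nbrs (retain G v E) u).card =
      ∑ u ∈ E, (a u v + b u v * ((1 - α) * p v / E.card)) := by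
    refine Finset.sum_congr rfl fun u hu => ?_
    have huv := (mem_nbrs.1 (hE hu)).symm
    have hadj : (retain G v E).Adj u v := by
      rw [SimpleGraph.adj_comm, ← mem_nbrs, nbrs_retain_self hE]
      exact hu
    have := flow_eq hG h0 h1 hm hp hadj (notMem_branch hG huv)
    rwa [nbrs_retain_self hE] at this
  rw [hsum, Finset.sum_add_distrib, ← Finset.sum_mul] at hst
  have hd : (0 : ℝ) < E.card := by exact_mod_cast hne.card_pos
  generalize (E.card : ℝ) = d at *
  have h2 : p v * d = (α * q v + (∑ w ∈ E, a w v + (∑ w ∈ E, b w v) * ((1 - α) * p v / d))) * d := by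
    rw [← hst]
  have h3 : (∑ w ∈ E, b w v) * ((1 - α) * p v / d) * d = (∑ w ∈ E, b w v) * ((1 - α) * p v) := by
    field_simp
  linear_combination h2 + h3

/-- This sign allows the denominator of the payoff to be cleared in an inequality. -/
theorem IsMessage.card_sub_pos (hG : G.IsAcyclic) {c : ℝ} {f : V → ℝ} (h0 : 0 < c) (h1 : c < 1)
    (hm : IsMessage G c f a b) {v : V} {E : Finset V} (hE : E ⊆ nbrs G v) (hne : E.Nonempty) :
    0 < E.card - c * ∑ w ∈ E, b w v := by
  have hb : ∀ w ∈ E, 0 < b w v ∧ b w v < 1 := fun w hw =>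
    hm.bounds hG h0 h1 (mem_nbrs.1 (hE hw)).symm
  have hs : ∑ w ∈ E, b w v ≤ E.card := by
    calc ∑ w ∈ E, b w v ≤ ∑ w ∈ E, (1 : ℝ) := Finset.sum_le_sum fun w hw => (hb w hw).2.le
      _ = E.card := by simp
  have hd : (0 : ℝ) < E.card := by exact_mod_cast hne.card_pos
  nlinarith

/-- Retaining all neighbours changes nothing, so the payoff equation also yields the present
PageRank. This is the quotient computed by `evaluate`. -/
theorem pageRank_eq (hG : G.IsAcyclic) (h0 : 0 < α) (h1 : α < 1) (hq : IsDistribution q)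
    (hm : IsMessage G (1 - α) (fun v => α * q v) a b) {v : V} (hv : (nbrs G v).Nonempty) :
    pageRank G α q v = (nbrs G v).card * (α * q v + ∑ w ∈ nbrs G v, a w v) /
      ((nbrs G v).card - (1 - α) * ∑ w ∈ nbrs G v, b w v) := by
  have h := pageRank_retain hG h0 h1 hq hm (Finset.Subset.refl (nbrs G v)) hv
  have hN : ((nbrs G v : Finset V) : Set V) = G.neighborSet v := by ext; simp
  rw [hN, retain_neighborSet] at h
  have hpos := hm.card_sub_pos hG (by linarith) (by linarith) (Finset.Subset.refl (nbrs G v)) hv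
  rw [eq_div_iff hpos.ne', h]

/-- The gain of keeping the neighbour `w` when `k` neighbours are kept in total. -/
def gain (k g : ℝ) (a b : V → V → ℝ) (v w : V) : ℝ := k * a w v + g * b w v

/-- Multiplying by the positive denominator makes the comparison with the present PageRank additive
over `E`. For a fixed cardinality, the threshold does not depend on `E`. -/
theorem isImproving_iff (hG : G.IsAcyclic) (h0 : 0 < α) (h1 : α < 1) (hq : IsDistribution q)
    (hm : IsMessage G (1 - α) (fun v => α * q v) a b) {v : V} {E : Finset V}
    (hE : E ⊆ nbrs G v) (hne : E.Nonempty) :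
    IsImproving G α q v E ↔ E.card * (pageRank G α q v - α * q v) <
      ∑ w ∈ E, gain E.card (pageRank G α q v * (1 - α)) a b v w := by
  have hpos := hm.card_sub_pos hG (by linarith) (by linarith) hE hne
  have hst : IsStrategy G v E := ⟨fun w hw => mem_nbrs.1 (hE hw), hne⟩
  have hpr := pageRank_retain hG h0 h1 hq hm hE hne
  simp only [gain, Finset.sum_add_distrib, ← Finset.mul_sum]
  rw [IsImproving, and_iff_right hst, ← mul_lt_mul_iff_left₀ hpos, hpr]
  constructor <;> intro h <;> linarith

end Payoff

end PageRankGame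

namespace RealRAM

/-! ### Reasoning about programs -/

section Memory

variable (s : Store) {a b : ℕ} (i x : ℕ) (y : ℝ)

@[simp] theorem Store.ints_setInt_self :
    (s.setInt a i x).ints a = Function.update (s.ints a) i x := by
  simp [Store.setInt]

@[simp] theorem Store.ints_setInt_of_ne (h : b ≠ a) : (s.setInt a i x).ints b = s.ints b := by
  simp [Store.setInt, h]

@[simp] theorem Store.reals_setInt : (s.setInt a i x).reals = s.reals := rfl

@[simp] theorem Store.reals_setReal_self :
    (s.setReal a i y).reals a = Function.update (s.reals a) i y := by
  simp [Store.setReal]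

@[simp] theorem Store.reals_setReal_of_ne (h : b ≠ a) :
    (s.setReal a i y).reals b = s.reals b := by
  simp [Store.setReal, h]

@[simp] theorem Store.ints_setReal : (s.setReal a i y).ints = s.ints := rfl

end Memory

/-- The integer arrays to which a program may write. -/
def Prog.intWrites : Prog → List ℕ
  | skip => []
  | setInt a _ _ => [a]
  | setReal _ _ _ => []
  | seq p r => p.intWrites ++ r.intWrites
  | branch _ p r => p.intWrites ++ r.intWrites
  | loop _ p => p.intWrites

/-- The real arrays to which a program may write. -/
def Prog.realWrites : Prog → List ℕ
  | skip => []
  | setInt _ _ _ => []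
  | setReal a _ _ => [a]
  | seq p r => p.realWrites ++ r.realWrites
  | branch _ p r => p.realWrites ++ r.realWrites
  | loop _ p => p.realWrites

/-- The memories `s` and `s'` agree on all arrays to which `p` does not write. -/
def Agree (p : Prog) (s s' : Store) : Prop :=
  (∀ a, a ∉ p.intWrites → s'.ints a = s.ints a) ∧
    ∀ a, a ∉ p.realWrites → s'.reals a = s.reals a

theorem Agree.refl (p : Prog) (s : Store) : Agree p s s := ⟨fun _ _ => rfl, fun _ _ => rfl⟩

theorem Agree.trans {p : Prog} {s s₁ s₂ : Store} (h₁ : Agree p s s₁) (h₂ : Agree p s₁ s₂) :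
    Agree p s s₂ :=
  ⟨fun a ha => (h₂.1 a ha).trans (h₁.1 a ha), fun a ha => (h₂.2 a ha).trans (h₁.2 a ha)⟩

theorem Agree.mono {p r : Prog} {s s' : Store} (h : Agree p s s')
    (hi : ∀ a ∈ p.intWrites, a ∈ r.intWrites) (hr : ∀ a ∈ p.realWrites, a ∈ r.realWrites) :
    Agree r s s' :=
  ⟨fun a ha => h.1 a fun h' => ha (hi a h'), fun a ha => h.2 a fun h' => ha (hr a h')⟩

/-- The frame rule. As the written arrays are determined by the program text, its side conditions
are decidable. -/
theorem Exec.agree {p : Prog} {s s' : Store} {t : ℕ} (h : Exec p s t s') : Agree p s s' := by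
  induction h with
  | skip s => exact Agree.refl _ _
  | setInt s a i e =>
    refine ⟨fun b hb => ?_, fun _ _ => rfl⟩
    exact s.ints_setInt_of_ne _ _ (by simpa [Prog.intWrites] using hb)
  | setReal s a i e =>
    refine ⟨fun _ _ => rfl, fun b hb => ?_⟩
    exact s.reals_setReal_of_ne _ _ (by simpa [Prog.realWrites] using hb)
  | seq _ _ ih ih' =>
    exact (ih.mono (by simp +contextual [Prog.intWrites])
      (by simp +contextual [Prog.realWrites])).trans
      (ih'.mono (by simp +contextual [Prog.intWrites]) (by simp +contextual [Prog.realWrites]))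
  | branchTrue _ _ ih =>
    exact ih.mono (by simp +contextual [Prog.intWrites]) (by simp +contextual [Prog.realWrites])
  | branchFalse _ _ ih =>
    exact ih.mono (by simp +contextual [Prog.intWrites]) (by simp +contextual [Prog.realWrites])
  | loopTrue _ _ _ ih ih' =>
    exact (ih.mono (r := .loop _ _) (fun _ h => h) (fun _ h => h)).trans ih'
  | loopFalse _ => exact Agree.refl _ _

/-- Started in memory `s`, the program `p` halts after at most `T` steps with a memory
satisfying `Q`. -/
def Does (p : Prog) (s : Store) (T : ℕ) (Q : Store → Prop) : Prop :=
  ∃ t s', Exec p s t s' ∧ t ≤ T ∧ Q s'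

theorem Does.mono {p : Prog} {s : Store} {T T' : ℕ} {Q Q' : Store → Prop} (h : Does p s T Q)
    (hT : T ≤ T') (hQ : ∀ s', Agree p s s' → Q s' → Q' s') : Does p s T' Q' := by
  obtain ⟨t, s', h1, h2, h3⟩ := h
  exact ⟨t, s', h1, h2.trans hT, hQ s' h1.agree h3⟩

theorem Does.seq {p r : Prog} {s : Store} {T₁ T₂ : ℕ} {Q : Store → Prop}
    (h : Does p s T₁ fun s' => Does r s' T₂ Q) : Does (.seq p r) s (T₁ + T₂) Q := by
  obtain ⟨t, s', h1, h2, t', s'', h3, h4, h5⟩ := h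
  exact ⟨_, s'', h1.seq h3, Nat.add_le_add h2 h4, h5⟩

/-- A program without loops. -/
def Prog.loopFree : Prog → Bool
  | skip => true
  | setInt _ _ _ => true
  | setReal _ _ _ => true
  | seq p r => p.loopFree && r.loopFree
  | branch _ p r => p.loopFree && r.loopFree
  | loop _ _ => false

/-- A bound on the running time of a program without loops. -/
def Prog.maxCost : Prog → ℕ
  | skip => 1
  | setInt _ i e => i.cost + e.cost + 1
  | setReal _ i e => i.cost + e.cost + 1
  | seq p r => p.maxCost + r.maxCost
  | branch b p r => b.cost + (p.maxCost + r.maxCost)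
  | loop b _ => b.cost

open Classical in
/-- The final memory of a program without loops. -/
noncomputable def Prog.run : Prog → Store → Store
  | skip, s => s
  | setInt a i e, s => s.setInt a (i.eval s) (e.eval s)
  | setReal a i e, s => s.setReal a (i.eval s) (e.eval s)
  | seq p r, s => r.run (p.run s)
  | branch b p r, s => if b.Holds s then p.run s else r.run s
  | loop _ _, s => s

theorem Prog.exec_run (p : Prog) (hp : p.loopFree = true) (s : Store) :
    ∃ t, Exec p s t (p.run s) ∧ t ≤ p.maxCost := by
  induction p generalizing s with
  | skip => exact ⟨_, .skip s, le_rfl⟩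
  | setInt a i e => exact ⟨_, .setInt s a i e, le_rfl⟩
  | setReal a i e => exact ⟨_, .setReal s a i e, le_rfl⟩
  | seq p r ihp ihr =>
    simp only [Prog.loopFree, Bool.and_eq_true] at hp
    obtain ⟨t, h1, h2⟩ := ihp hp.1 s
    obtain ⟨t', h3, h4⟩ := ihr hp.2 (p.run s)
    exact ⟨_, h1.seq h3, Nat.add_le_add h2 h4⟩
  | branch b p r ihp ihr =>
    simp only [Prog.loopFree, Bool.and_eq_true] at hp
    by_cases hb : b.Holds s
    · obtain ⟨t, h1, h2⟩ := ihp hp.1 s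
      rw [Prog.run, if_pos hb]
      exact ⟨_, .branchTrue hb h1, by simp only [Prog.maxCost]; omega⟩
    · obtain ⟨t, h1, h2⟩ := ihr hp.2 s
      rw [Prog.run, if_neg hb]
      exact ⟨_, .branchFalse hb h1, by simp only [Prog.maxCost]; omega⟩
  | loop b p _ => simp [Prog.loopFree] at hp

theorem Does.of_run {p : Prog} {s : Store} {T : ℕ} {Q : Store → Prop} (hp : p.loopFree = true)
    (hT : p.maxCost ≤ T) (hQ : Q (p.run s)) : Does p s T Q := by
  obtain ⟨t, h1, h2⟩ := p.exec_run hp s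
  exact ⟨t, _, h1, h2.trans hT, hQ⟩

theorem Does.branch {b : Cond} {p r : Prog} {s : Store} {T : ℕ} {Q : Store → Prop}
    (hp : b.Holds s → Does p s T Q) (hr : ¬ b.Holds s → Does r s T Q) :
    Does (.branch b p r) s (b.cost + T) Q := by
  by_cases hb : b.Holds s
  · obtain ⟨t, s', h1, h2, h3⟩ := hp hb
    exact ⟨_, s', .branchTrue hb h1, by omega, h3⟩
  · obtain ⟨t, s', h1, h2, h3⟩ := hr hb
    exact ⟨_, s', .branchFalse hb h1, by omega, h3⟩

/-- The running time of a loop is paid for by the decrease of a potential. -/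
theorem exists_exec_loop {b : Cond} {p : Prog} (Inv : Store → Prop) (μ : Store → ℕ)
    (hcost : 0 < b.cost)
    (hstep : ∀ s, Inv s → b.Holds s →
      ∃ t s', Exec p s t s' ∧ Inv s' ∧ b.cost + t + μ s' ≤ μ s) (s : Store) (hs : Inv s) :
    ∃ t s', Exec (.loop b p) s t s' ∧ t + μ s' ≤ μ s + b.cost ∧ Inv s' ∧ ¬ b.Holds s' := by
  induction hr : μ s using Nat.strong_induction_on generalizing s with
  | _ r ih =>
    by_cases hb : b.Holds s
    · obtain ⟨t, s', h1, h2, h3⟩ := hstep s hs hb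
      -- The test has positive cost, so the potential strictly decreases and the induction is well
      -- founded.
      obtain ⟨t', s'', h4, h5, h6⟩ := ih (μ s') (by omega) s' h2 rfl
      exact ⟨_, s'', .loopTrue hb h1 h4, by omega, h6⟩
    · exact ⟨_, s, .loopFalse hb, by omega, hs, hb⟩

theorem Cond.cost_pos (b : Cond) : 0 < b.cost := by
  cases b <;> simp [Cond.cost]

/-- Entry `0` of an integer array, used as a variable. -/
abbrev NExpr.var (x : ℕ) : NExpr := .get x (.const 0)

/-- Entry `0` of a real array, used as a variable. -/
abbrev RExpr.var (x : ℕ) : RExpr := .get x (.const 0)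

/-- Run `p` with the variable `x` ranging over the numbers below `e`. -/
def forLoop (x : ℕ) (e : NExpr) (p : Prog) : Prog :=
  .seq (.setInt x (.const 0) (.const 0))
    (.loop (.natLt (.var x) e)
      (.seq p (.setInt x (.const 0) (.add (.var x) (.const 1)))))

/-- A potential-based rule for counting loops: the potential at the end remains available. -/
theorem exists_exec_forLoop {x : ℕ} {e : NExpr} {p : Prog} {s : Store} {N : ℕ}
    (Inv : ℕ → Store → Prop) (μ : ℕ → Store → ℕ) (hx : x ∉ p.intWrites)
    (hN : ∀ s', Agree (forLoop x e p) s s' → e.eval s' = N)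
    (h0 : Inv 0 (s.setInt x 0 0))
    (hstep : ∀ i s', i < N → Agree (forLoop x e p) s s' → s'.ints x 0 = i → Inv i s' →
      ∃ t s'', Exec p s' t s'' ∧ Inv (i + 1) (s''.setInt x 0 (i + 1)) ∧
        e.cost + 9 + t + μ (i + 1) (s''.setInt x 0 (i + 1)) ≤ μ i s') :
    ∃ t s', Exec (forLoop x e p) s t s' ∧
      t + μ N s' ≤ μ 0 (s.setInt x 0 0) + e.cost + 6 ∧ Inv N s' := by
  have hxw : x ∈ (forLoop x e p).intWrites := by simp [forLoop, Prog.intWrites]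
  have hset : ∀ (s' : Store) (y : ℕ), Agree (forLoop x e p) s s' →
      Agree (forLoop x e p) s (s'.setInt x 0 y) := fun s' y h =>
    ⟨fun a ha => by
      rw [← h.1 a ha, Store.ints_setInt_of_ne]
      rintro rfl
      exact ha hxw, h.2⟩
  obtain ⟨t, s', h1, h2, ⟨h3, h4, h5⟩, h6⟩ :=
    exists_exec_loop (b := .natLt (.var x) e)
      (p := .seq p (.setInt x (.const 0) (.add (.var x) (.const 1))))
      (fun s' => Agree (forLoop x e p) s s' ∧ s'.ints x 0 ≤ N ∧ Inv (s'.ints x 0) s')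
      (fun s' => μ (s'.ints x 0) s') (Cond.cost_pos _) (by
        rintro s' ⟨ha, hle, hI⟩ hb
        simp only [Cond.Holds, NExpr.eval, hN s' ha] at hb
        obtain ⟨t, s'', h1, h2, h3⟩ := hstep _ s' hb ha rfl hI
        have hxe : s''.ints x 0 = s'.ints x 0 := by rw [h1.agree.1 x hx]
        have hex := h1.seq (.setInt s'' x (.const 0) (.add (.var x) (.const 1)))
        simp only [NExpr.eval, hxe] at hex
        have ha' : Agree (forLoop x e p) s s'' := ha.trans (h1.agree.mono
          (by simp +contextual [forLoop, Prog.intWrites])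
          (by simp +contextual [forLoop, Prog.realWrites]))
        refine ⟨_, _, hex, ⟨hset _ _ ha', ?_, ?_⟩, ?_⟩
        · simp; omega
        · simpa using h2
        -- The test costs `e.cost + 3` and the increment 6, which gives `e.cost + 9` per round.
        -- Initialisation costs 3 and the last test `e.cost + 3`, hence `e.cost + 6` outside the
        -- rounds.
        · simp only [Store.ints_setInt_self, Function.update_self, Cond.cost, NExpr.cost]
          omega)
      (s.setInt x 0 0) ⟨hset _ _ (Agree.refl _ _), by simp, by simpa using h0⟩
  simp only [Cond.Holds, NExpr.eval, hN s' h3] at h6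
  have hxN : s'.ints x 0 = N := by omega
  rw [hxN] at h5 h2
  refine ⟨_, s', (Exec.setInt s x (.const 0) (.const 0)).seq h1, ?_, h5⟩
  simp only [Store.ints_setInt_self, Function.update_self, Cond.cost, NExpr.cost] at h2 ⊢
  omega

/-- The special case in which the potential is the total budget of the outstanding rounds. The
general rule is needed where the cost of the rounds is amortised. -/
theorem Does.forLoop {x : ℕ} {e : NExpr} {p : Prog} {s : Store} (N : ℕ) (T : ℕ → ℕ)
    (Inv : ℕ → Store → Prop) (hx : x ∉ p.intWrites)
    (hN : ∀ s', Agree (forLoop x e p) s s' → e.eval s' = N)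
    (h0 : Inv 0 (s.setInt x 0 0))
    (hstep : ∀ i s', i < N → Agree (RealRAM.forLoop x e p) s s' → s'.ints x 0 = i → Inv i s' →
      Does p s' (T i) fun s'' => Inv (i + 1) (s''.setInt x 0 (i + 1))) :
    Does (forLoop x e p) s (∑ i ∈ Finset.range N, (T i + e.cost + 9) + e.cost + 6) (Inv N) := by
  obtain ⟨t, s', h1, h2, h3⟩ := exists_exec_forLoop (e := e) Inv
    (fun i _ => ∑ j ∈ Finset.Ico i N, (T j + e.cost + 9)) hx hN h0 (by
      intro i s' hi ha hxi hI
      obtain ⟨t, s'', h1, h2, h3⟩ := hstep i s' hi ha hxi hI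
      refine ⟨t, s'', h1, h3, ?_⟩
      rw [Finset.sum_eq_sum_Ico_succ_bot hi]
      omega)
  refine ⟨t, s', h1, ?_, h3⟩
  rw [Finset.range_eq_Ico]
  omega

end RealRAM

namespace RealRAM

/-! ### Sorting an enumeration -/

section Enumeration

variable {d : ℕ} {σ : ℕ → ℕ} {f : ℕ → ℝ}

/-- The sum of the first `k` values of a nonincreasing sequence is maximal. -/
theorem sum_le_sum_range {d : ℕ} {h : ℕ → ℝ} (hh : ∀ i j, i ≤ j → j < d → h j ≤ h i)
    {S : Finset ℕ} (hS : ∀ i ∈ S, i < d) : ∑ i ∈ S, h i ≤ ∑ i ∈ Finset.range S.card, h i := by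
  set R := Finset.range S.card with hR
  rw [← Finset.sum_inter_add_sum_sdiff R S h, ← Finset.sum_inter_add_sum_sdiff S R h,
    Finset.inter_comm]
  -- After cancelling the common part, equally many values remain on both sides. The value at
  -- position `S.card` separates them; if something remains, some `m ≥ S.card` below `d` shows that
  -- this position is in range.
  have hc : (S \ R).card = (R \ S).card := Finset.card_sdiff_comm (by simp [hR])
  rcases (S \ R).eq_empty_or_nonempty with he | ⟨m, hm⟩
  · rw [he, Finset.card_empty, eq_comm, Finset.card_eq_zero] at hc
    rw [he, hc]
  · have hm' := Finset.mem_sdiff.1 hm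
    rw [hR, Finset.mem_range, not_lt] at hm'
    have hmd := hS m hm'.1
    have hub : ∑ i ∈ S \ R, h i ≤ (S \ R).card • h S.card := by
      refine Finset.sum_le_card_nsmul _ _ _ fun i hi => ?_
      rw [Finset.mem_sdiff, hR, Finset.mem_range, not_lt] at hi
      exact hh _ _ hi.2 (hS i hi.1)
    have hlb : (R \ S).card • h S.card ≤ ∑ i ∈ R \ S, h i := by
      refine Finset.card_nsmul_le_sum _ _ _ fun i hi => ?_
      rw [Finset.mem_sdiff, hR, Finset.mem_range] at hi
      exact hh _ _ hi.1.le (by omega)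
    rw [hc] at hub
    linarith

/-- The positions of an enumeration that are out of order with respect to `f`. -/
noncomputable def inversions (d : ℕ) (f : ℕ → ℝ) (σ : ℕ → ℕ) : Finset (ℕ × ℕ) :=
  open Classical in
  (Finset.range d ×ˢ Finset.range d).filter fun x => x.1 < x.2 ∧ f (σ x.1) < f (σ x.2)

theorem mem_inversions {x : ℕ × ℕ} :
    x ∈ inversions d f σ ↔ (x.1 < d ∧ x.2 < d) ∧ x.1 < x.2 ∧ f (σ x.1) < f (σ x.2) := by
  simp [inversions]

theorem card_inversions_le (d : ℕ) (f : ℕ → ℝ) (σ : ℕ → ℕ) :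
    (inversions d f σ).card ≤ d * d := by
  classical
  refine (Finset.card_filter_le _ _).trans ?_
  simp

theorem swap_succ_cases (p i : ℕ) : (i = p ∧ Equiv.swap p (p + 1) i = p + 1) ∨
    (i = p + 1 ∧ Equiv.swap p (p + 1) i = p) ∨
    (i ≠ p ∧ i ≠ p + 1 ∧ Equiv.swap p (p + 1) i = i) := by
  by_cases h1 : i = p
  · subst h1; exact Or.inl ⟨rfl, Equiv.swap_apply_left _ _⟩
  by_cases h2 : i = p + 1
  · subst h2; exact Or.inr (Or.inl ⟨rfl, Equiv.swap_apply_right _ _⟩)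
  · exact Or.inr (Or.inr ⟨h1, h2, Equiv.swap_apply_of_ne_of_ne h1 h2⟩)

theorem swap_succ_lt_swap_succ {p i j : ℕ} (hij : i < j) :
    (i = p ∧ j = p + 1) ∨ Equiv.swap p (p + 1) i < Equiv.swap p (p + 1) j := by
  have h1 := swap_succ_cases p i
  have h2 := swap_succ_cases p j
  omega

theorem swap_succ_lt {p i : ℕ} (hp : p + 1 < d) (hi : i < d) : Equiv.swap p (p + 1) i < d := by
  have := swap_succ_cases p i
  omega

/-- Exchanging two adjacent entries that are out of order removes an inversion. -/
theorem card_inversions_swap_lt {p : ℕ} (hp : p + 1 < d) (h : f (σ p) < f (σ (p + 1))) :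
    (inversions d f (σ ∘ Equiv.swap p (p + 1))).card < (inversions d f σ).card := by
  have hmem : (p, p + 1) ∈ inversions d f σ := mem_inversions.2 ⟨⟨by omega, hp⟩, by simp, h⟩
  rw [← Finset.card_erase_add_one hmem, Nat.lt_succ_iff]
  -- Transposing positions embeds the new inversions into the old ones. The pair `(p, p + 1)` is
  -- missed, since it is in order after the exchange.
  refine Finset.card_le_card_of_injOn
    (fun x => (Equiv.swap p (p + 1) x.1, Equiv.swap p (p + 1) x.2)) ?_ ?_
  · rintro ⟨i, j⟩ hx
    simp only [Finset.mem_coe, mem_inversions, Function.comp_apply] at hx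
    simp only [Finset.coe_erase, Set.mem_sdiff, Finset.mem_coe, mem_inversions,
      Set.mem_singleton_iff, Prod.mk.injEq]
    obtain ⟨⟨hi, hj⟩, hij, hf⟩ := hx
    have h1 := swap_succ_cases p i
    have h2 := swap_succ_cases p j
    have hlt : Equiv.swap p (p + 1) i < Equiv.swap p (p + 1) j := by
      rcases swap_succ_lt_swap_succ (p := p) hij with ⟨rfl, rfl⟩ | hlt
      · rw [Equiv.swap_apply_left, Equiv.swap_apply_right] at hf
        exact absurd hf (lt_asymm h)
      · exact hlt
    exact ⟨⟨⟨swap_succ_lt hp hi, swap_succ_lt hp hj⟩, hlt, hf⟩, by omega⟩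
  · rintro ⟨i, j⟩ _ ⟨i', j'⟩ _ hx
    simpa using hx

theorem bijOn_comp_swap {X : Set ℕ} {p r : ℕ} (hp : p < d) (hr : r < d)
    (h : Set.BijOn σ (Set.Iio d) X) : Set.BijOn (σ ∘ Equiv.swap p r) (Set.Iio d) X := by
  refine h.comp ⟨fun i hi => ?_, (Equiv.swap p r).injective.injOn, fun i hi => ?_⟩
  · rw [Equiv.swap_apply_def]
    split_ifs <;> assumption
  · refine ⟨Equiv.swap p r i, ?_, Equiv.swap_apply_self _ _ _⟩
    rw [Equiv.swap_apply_def]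
    split_ifs <;> assumption

/-- This identifies the memory after the two array writes of an exchange. -/
theorem comp_swap_eq_update (σ : ℕ → ℕ) (p r : ℕ) :
    σ ∘ Equiv.swap p r = Function.update (Function.update σ r (σ p)) p (σ r) := by
  funext i
  simp only [Function.comp_apply, Function.update_apply, Equiv.swap_apply_def]
  split_ifs <;> rfl

theorem antitone_of_step {h : ℕ → ℝ} (hh : ∀ i, i + 1 < d → h (i + 1) ≤ h i) (i j : ℕ)
    (hij : i ≤ j) (hj : j < d) : h j ≤ h i := by
  induction j, hij using Nat.le_induction with
  | base => exact le_rfl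
  | succ j _ ih => exact (hh j hj).trans (ih (by omega))

/-- Pulled back along the enumeration, `E` becomes a set of positions, and initial positions are
optimal for a nonincreasing sequence. This is why one strategy per cardinality suffices. -/
theorem sum_le_sum_range_of_bijOn {X : Set ℕ} (hσ : Set.BijOn σ (Set.Iio d) X)
    (hs : ∀ i, i + 1 < d → f (σ (i + 1)) ≤ f (σ i)) {E : Finset ℕ} (hE : ∀ u ∈ E, u ∈ X) :
    ∑ u ∈ E, f u ≤ ∑ i ∈ Finset.range E.card, f (σ i) := by
  classical
  set S := (Finset.range d).filter fun i => σ i ∈ E with hS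
  have himg : S.image σ = E := by
    ext u
    simp only [hS, Finset.mem_image, Finset.mem_filter, Finset.mem_range]
    constructor
    · rintro ⟨i, ⟨_, hi⟩, rfl⟩
      exact hi
    · intro hu
      obtain ⟨i, hi, rfl⟩ := hσ.surjOn (hE u hu)
      exact ⟨i, ⟨hi, hu⟩, rfl⟩
  have hinj : Set.InjOn σ S := hσ.injOn.mono fun i hi => by
    simp only [hS, Finset.coe_filter, Finset.mem_range, Set.mem_ofPred_eq] at hi
    exact hi.1
  rw [← himg, Finset.sum_image hinj, Finset.card_image_of_injOn hinj]
  exact sum_le_sum_range (h := fun i => f (σ i)) (antitone_of_step hs) fun i hi => by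
    simp only [hS, Finset.mem_filter, Finset.mem_range] at hi
    exact hi.1

end Enumeration

/-- The value of the neighbour `e` in round `k`: `k + 1` times its entry in real array `9` plus
the variable `8` times its entry in real array `10`. Round numbers are kept in the variable `13`. -/
def keyAt (e : NExpr) : RExpr :=
  .add (.mul (.ofNat (.add (.var 13) (.const 1))) (.get 9 e)) (.mul (.var 8) (.get 10 e))

/-- The function computed by `keyAt`. -/
def key (s : Store) (u : ℕ) : ℝ :=
  ((s.ints 13 0 + 1 : ℕ) : ℝ) * s.reals 9 u + s.reals 8 0 * s.reals 10 u

theorem eval_keyAt (s : Store) (e : NExpr) : (keyAt e).eval s = key s (e.eval s) := rfl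

/-- Exchange the entry of integer array `7` at the position stored in the variable `14` with its
predecessor and step back if the two are out of order, else step forward. -/
def gnomeStep : Prog :=
  .branch
    (.and (.natLt (.const 0) (.var 14))
      (.realLt (keyAt (.get 7 (.sub (.var 14) (.const 1)))) (keyAt (.get 7 (.var 14)))))
    (.seq (.setInt 15 (.const 0) (.get 7 (.sub (.var 14) (.const 1))))
      (.seq (.setInt 7 (.sub (.var 14) (.const 1)) (.get 7 (.var 14)))
        (.seq (.setInt 7 (.var 14) (.var 15))
          (.setInt 14 (.const 0) (.sub (.var 14) (.const 1))))))
    (.setInt 14 (.const 0) (.add (.var 14) (.const 1)))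

/-- Sort the first entries of integer array `7` by decreasing key, where the variable `12` holds
the number of entries. -/
def gnomeSort : Prog :=
  .seq (.setInt 14 (.const 0) (.const 0)) (.loop (.natLt (.var 14) (.var 12)) gnomeStep)

/-- The time for sorting is linear in the number of entries and of removed inversions. Here the
inversions may be counted with respect to any function `f` for which the entries are out of order
whenever they are out of order with respect to the key. -/
theorem exists_exec_gnomeSort (s : Store) {d : ℕ} {X : Set ℕ} (f : ℕ → ℝ)
    (hd : s.ints 12 0 = d) (hσ : Set.BijOn (s.ints 7) (Set.Iio d) X)
    (hf : ∀ i j, i < j → j < d → key s (s.ints 7 i) < key s (s.ints 7 j) →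
      f (s.ints 7 i) < f (s.ints 7 j)) :
    ∃ t s', Exec gnomeSort s t s' ∧ Set.BijOn (s'.ints 7) (Set.Iio d) X ∧
      (∀ i, i + 1 < d → key s (s'.ints 7 (i + 1)) ≤ key s (s'.ints 7 i)) ∧
      t + 200 * (inversions d f (s'.ints 7)).card ≤
        100 * d + 200 * (inversions d f (s.ints 7)).card + 100 := by
  obtain ⟨t, s', h1, h2, ⟨-, hle, h3, h4, -⟩, h5⟩ := exists_exec_loop
    (b := .natLt (.var 14) (.var 12))
    (p := (.branch
        (.and (.natLt (.const 0) (.var 14))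
          (.realLt (keyAt (.get 7 (.sub (.var 14) (.const 1)))) (keyAt (.get 7 (.var 14)))))
        (.seq (.setInt 15 (.const 0) (.get 7 (.sub (.var 14) (.const 1))))
          (.seq (.setInt 7 (.sub (.var 14) (.const 1)) (.get 7 (.var 14)))
            (.seq (.setInt 7 (.var 14) (.var 15))
              (.setInt 14 (.const 0) (.sub (.var 14) (.const 1))))))
        (.setInt 14 (.const 0) (.add (.var 14) (.const 1)))))
    (fun s' => ((∀ u, key s' u = key s u) ∧ s'.ints 12 0 = d) ∧ s'.ints 14 0 ≤ d ∧
      Set.BijOn (s'.ints 7) (Set.Iio d) X ∧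
      (∀ i, i + 1 < s'.ints 14 0 → key s (s'.ints 7 (i + 1)) ≤ key s (s'.ints 7 i)) ∧
      ∀ i j, i < j → j < d → key s (s'.ints 7 i) < key s (s'.ints 7 j) →
        f (s'.ints 7 i) < f (s'.ints 7 j))
    -- A step forward releases 100. An exchange takes back 100 for the step backwards but releases
    -- at least 200 for a removed inversion, so every step has 100 to spend.
    (fun s' => 100 * (d - s'.ints 14 0) + 200 * (inversions d f (s'.ints 7)).card)
    (Cond.cost_pos _) (by
      rintro s' ⟨⟨hk, hd'⟩, hle, hX, hs, hf'⟩ hb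
      simp only [Cond.Holds, NExpr.eval, hd'] at hb
      by_cases hc : 0 < s'.ints 14 0 ∧
          key s (s'.ints 7 (s'.ints 14 0 - 1)) < key s (s'.ints 7 (s'.ints 14 0))
      · obtain ⟨p, hp⟩ : ∃ p, s'.ints 14 0 = p + 1 := ⟨_, (Nat.succ_pred_eq_of_pos hc.1).symm⟩
        rw [hp, Nat.add_sub_cancel] at hc
        rw [hp] at hb hs
        obtain ⟨t, hex, ht⟩ := gnomeStep.exec_run rfl s'
        rw [gnomeStep, Prog.run, if_pos (by
          simp only [Cond.Holds, eval_keyAt, NExpr.eval, hk, hp, Nat.add_sub_cancel]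
          exact hc)] at hex
        have hσ' : s'.ints 7 ∘ Equiv.swap p (p + 1) = Function.update
            (Function.update (s'.ints 7) p (s'.ints 7 (p + 1))) (p + 1) (s'.ints 7 p) := by
          rw [Equiv.swap_comm, comp_swap_eq_update]
        refine ⟨t, _, hex, ⟨⟨?_, ?_⟩, ?_, ?_, ?_, ?_⟩, ?_⟩
        · intro u
          rw [← hk u]
          simp [Prog.run, NExpr.eval, key]
        · simp [Prog.run, NExpr.eval, hd']
        · simp [Prog.run, NExpr.eval, hp]; omega
        · simp only [Prog.run, NExpr.eval]
          simp [hp]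
          rw [← hσ']
          exact bijOn_comp_swap (by omega) hb hX
        · simp only [Prog.run, NExpr.eval]
          simp [hp]
          intro i hi
          rw [← hσ']
          simp only [Function.comp_apply]
          rw [Equiv.swap_apply_of_ne_of_ne (by omega) (by omega),
            Equiv.swap_apply_of_ne_of_ne (by omega) (by omega)]
          exact hs i (by omega)
        · simp only [Prog.run, NExpr.eval]
          simp [hp]
          rw [← hσ']
          intro i j hij hj hlt
          simp only [Function.comp_apply] at hlt ⊢
          -- The exchange creates no new pair out of order, so the hypothesis relating the key to
          -- `f` persists.
          rcases swap_succ_lt_swap_succ (p := p) hij with ⟨rfl, rfl⟩ | hlt'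
          · rw [Equiv.swap_apply_left, Equiv.swap_apply_right] at hlt
            exact absurd hlt (lt_asymm hc.2)
          · exact hf' _ _ hlt' (swap_succ_lt hb hj) hlt
        · simp only [Prog.run, NExpr.eval]
          simp [hp]
          rw [← hσ']
          -- The exchanged pair is out of order for the key, hence also for `f`; the inversions of
          -- `f` are the ones that pay.
          have := card_inversions_swap_lt hb (hf' p (p + 1) (by omega) hb hc.2)
          simp [gnomeStep, Prog.maxCost, Cond.cost, NExpr.cost, RExpr.cost, keyAt] at ht ⊢
          omega
      · obtain ⟨t, hex, ht⟩ := gnomeStep.exec_run rfl s'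
        rw [gnomeStep, Prog.run, if_neg (by
          simp only [Cond.Holds, eval_keyAt, NExpr.eval, hk]
          exact hc)] at hex
        refine ⟨t, _, hex, ⟨⟨?_, ?_⟩, ?_, ?_, ?_, ?_⟩, ?_⟩
        · intro u
          rw [← hk u]
          simp [Prog.run, NExpr.eval, key]
        · simp [Prog.run, NExpr.eval, hd']
        · simp [Prog.run, NExpr.eval]; omega
        · simpa [Prog.run, NExpr.eval] using hX
        · simp only [Prog.run, NExpr.eval]
          simp
          intro i hi
          rcases (by omega : i + 1 < s'.ints 14 0 ∨ i + 1 = s'.ints 14 0) with h | h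
          · exact hs i h
          · by_contra hcon
            refine hc ⟨by omega, ?_⟩
            rw [← h, Nat.add_sub_cancel]
            exact not_le.1 hcon
        · simpa [Prog.run, NExpr.eval] using hf'
        · simp [Prog.run, NExpr.eval]
          simp [gnomeStep, Prog.maxCost, Cond.cost, NExpr.cost, RExpr.cost, keyAt] at ht ⊢
          omega)
    (s.setInt 14 0 0) ⟨⟨fun u => by simp [key], by simpa using hd⟩, by simp, by simpa using hσ,
      by simp, by simpa using hf⟩
  refine ⟨_, s', (Exec.setInt s 14 (.const 0) (.const 0)).seq h1, h3, ?_, ?_⟩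
  · intro i hi
    refine h4 i ?_
    have := h1.agree.1 12 (by decide)
    simp only [Cond.Holds, NExpr.eval, this] at h5
    simp at h5
    omega
  · simp [Cond.cost, NExpr.cost] at h2 ⊢
    omega

end RealRAM

namespace PageRankGame

open RealRAM

/-! ### Arcs -/

section Arcs

variable {n : ℕ}

/-- `S` and `D` list the two endpoints of every arc of `G` exactly once. -/
structure IsArcList (G : SimpleGraph (Fin n)) (M : ℕ) (S D : ℕ → Fin n) : Prop where
  adj : ∀ i < M, G.Adj (S i) (D i)
  surj : ∀ u v, G.Adj u v → ∃ i < M, S i = u ∧ D i = v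
  inj : ∀ i < M, ∀ j < M, S i = S j → D i = D j → i = j

/-- The index of the arc opposite to arc `i`. -/
def revArc (m i : ℕ) : ℕ := if i < m then m + i else i - m

/-- The arcs with target `v` among the first `M` arcs. -/
def arcsInto (D : ℕ → Fin n) (M : ℕ) (v : Fin n) : Finset ℕ :=
  (Finset.range M).filter fun i => D i = v

theorem mem_arcsInto {D : ℕ → Fin n} {M i : ℕ} {v : Fin n} :
    i ∈ arcsInto D M v ↔ i < M ∧ D i = v := by
  simp [arcsInto]

theorem arcsInto_succ (D : ℕ → Fin n) (i : ℕ) (v : Fin n) :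
    (arcsInto D (i + 1) v).card = (arcsInto D i v).card + if D i = v then 1 else 0 := by
  rw [arcsInto, Finset.range_add_one, Finset.filter_insert]
  split_ifs
  · rw [Finset.card_insert_of_notMem (by simp), arcsInto]
  · rfl

/-- Changing one message affects only the sum at its target, and by the difference. The stored sums
can thus be maintained in constant time. -/
theorem sum_arcsInto_update (D : ℕ → Fin n) {M j : ℕ} (hj : j < M) (v : Fin n) (f : ℕ → ℝ)
    (x : ℝ) : ∑ i ∈ arcsInto D M v, Function.update f j x i =
      ∑ i ∈ arcsInto D M v, f i + if D j = v then x - f j else 0 := by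
  split_ifs with h
  · have hm : j ∈ arcsInto D M v := mem_arcsInto.2 ⟨hj, h⟩
    rw [Finset.sum_update_of_mem hm, ← Finset.sum_sdiff (Finset.singleton_subset_iff.2 hm),
      Finset.sum_singleton]
    ring
  · rw [add_zero]
    refine Finset.sum_congr rfl fun i hi => Function.update_of_ne ?_ _ _
    rintro rfl
    exact h (mem_arcsInto.1 hi).2

variable {G : SimpleGraph (Fin n)} {M : ℕ} {S D : ℕ → Fin n}

theorem IsArcList.sum_arcsInto {R : Type*} [AddCommMonoid R] (h : IsArcList G M S D) (v : Fin n)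
    (f : Fin n → R) : ∑ i ∈ arcsInto D M v, f (S i) = ∑ u ∈ nbrs G v, f u := by
  refine Finset.sum_bij (fun i _ => S i) ?_ ?_ ?_ fun _ _ => rfl
  · intro i hi
    rw [mem_arcsInto] at hi
    rw [mem_nbrs, ← hi.2]
    exact (h.adj i hi.1).symm
  · intro i hi j hj hij
    rw [mem_arcsInto] at hi hj
    exact h.inj i hi.1 j hj.1 hij (hi.2.trans hj.2.symm)
  · intro u hu
    obtain ⟨i, hi, h1, h2⟩ := h.surj u v (mem_nbrs.1 hu).symm
    exact ⟨i, mem_arcsInto.2 ⟨hi, h2⟩, h1⟩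

theorem IsArcList.card_arcsInto (h : IsArcList G M S D) (v : Fin n) :
    (arcsInto D M v).card = (nbrs G v).card := by
  rw [Finset.card_eq_sum_ones, Finset.card_eq_sum_ones]
  exact h.sum_arcsInto v fun _ => 1

theorem IsArcList.sum_card_nbrs (h : IsArcList G M S D) : ∑ v, (nbrs G v).card = M := by
  simp only [← h.card_arcsInto, arcsInto]
  rw [← Finset.card_eq_sum_card_fiberwise (fun _ _ => Finset.mem_coe.2 (Finset.mem_univ _)),
    Finset.card_range]

theorem exists_isArcList {es : List (Fin n × Fin n)} (hes : IsEdgeList G es) (v₀ : Fin n) :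
    ∃ S D : ℕ → Fin n, IsArcList G (es.length + es.length) S D ∧
      (∀ i < es.length, es[i]? = some (S i, D i)) ∧
      ∀ i < es.length, S (es.length + i) = D i ∧ D (es.length + i) = S i := by
  set m := es.length with hm
  -- The default `v₀` is never looked at, as only indices below the length of the list matter.
  let P : ℕ → Fin n × Fin n := fun i => es.getD i (v₀, v₀)
  have hP : ∀ i < m, es[i]? = some (P i) := by
    intro i hi
    simp [P, List.getD, List.getElem?_eq_getElem (hm ▸ hi)]
  have hadj : ∀ i < m, G.Adj (P i).1 (P i).2 := by
    intro i hi
    rw [← SimpleGraph.mem_edgeSet, ← hes.2]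
    exact List.mem_map.2 ⟨P i, List.mem_of_getElem? (hP i hi), rfl⟩
  have hinj : ∀ i < m, ∀ j < m, s((P i).1, (P i).2) = s((P j).1, (P j).2) → i = j := by
    intro i hi j hj hij
    refine (List.getElem?_inj (by simpa using hi) hes.1).1 ?_
    rw [List.getElem?_map, List.getElem?_map, hP i hi, hP j hj]
    simpa using hij
  refine ⟨fun i => if i < m then (P i).1 else (P (i - m)).2,
    fun i => if i < m then (P i).2 else (P (i - m)).1, ⟨?_, ?_, ?_⟩, ?_, ?_⟩
  · intro i hi
    split_ifs with h
    · exact hadj i h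
    · exact (hadj (i - m) (by omega)).symm
  · intro u v huv
    rw [← SimpleGraph.mem_edgeSet, ← hes.2] at huv
    obtain ⟨e, he, hee⟩ := List.mem_map.1 huv
    obtain ⟨i, hi⟩ := List.mem_iff_getElem?.1 he
    have him : i < m := (List.getElem?_eq_some_iff.1 hi).1
    rw [hP i him, Option.some_inj] at hi
    subst hi
    rcases Sym2.eq_iff.1 hee with ⟨h1, h2⟩ | ⟨h1, h2⟩
    · exact ⟨i, by omega, by simp [him, h1], by simp [him, h2]⟩
    · exact ⟨m + i, by omega, by simp [h2], by simp [h1]⟩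
  · intro i hi j hj h1 h2
    split_ifs at h1 h2 with h3 h4 h4
    · exact hinj i h3 j h4 (by rw [h1, h2])
    -- An arc coinciding with a reversed one would have to be its own opposite, that is, a loop.
    · have := hinj i h3 (j - m) (by omega) (by rw [h1, h2, Sym2.eq_swap])
      rw [← this] at h1
      exact absurd h1 (hadj i h3).ne
    · have := hinj (i - m) (by omega) j h4 (by rw [h1, h2, Sym2.eq_swap])
      rw [← this] at h1
      exact absurd h1.symm (hadj (i - m) (by omega)).ne
    · have := hinj (i - m) (by omega) (j - m) (by omega) (by rw [h1, h2])
      omega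
  · intro i hi
    simp only [hi, if_true]
    exact hP i hi
  · intro i hi
    simp [hi]

end Arcs

/-! ### Loading the input

The program uses the following arrays besides those for input and output. Integer arrays: `1` and
`2` are extended to sources and targets of all arcs, `5` holds the opposite arcs and `6` the
degrees, `7` the list of neighbours to be sorted. Real arrays: `2` and `3` hold the messages `b` and
`a` along the arcs, `4` and `5` their sums by target, `9` and `10` the messages `a` and `b` to the
current player by source. Variables for integers: `10` an inner loop, `11` a pass or the current
player, `12` her degree, `13` the round, `14` and `15` sorting, `16` the number of arcs. Variables
for reals: `6` holds `1 - α`, `7` the PageRank of the current player, `8` its product with `1 - α`,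
`11` a sum, `12` and `13` new messages, `14` a threshold. -/

section Load

variable {n : ℕ}

/-- The graph is stored in memory. -/
structure Loaded (G : SimpleGraph (Fin n)) (α : ℝ) (q : Fin n → ℝ) (m : ℕ) (S D : ℕ → Fin n)
    (s : Store) : Prop where
  size : s.ints 0 0 = n
  arcs : s.ints 16 0 = m + m
  src : ∀ i < m + m, s.ints 1 i = S i
  dst : ∀ i < m + m, s.ints 2 i = D i
  rev : ∀ i < m + m, s.ints 5 i = revArc m i
  deg : ∀ v : Fin n, s.ints 6 v = (nbrs G v).card
  alpha : s.reals 0 0 = α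
  link : s.reals 6 0 = 1 - α
  jump : ∀ v : Fin n, s.reals 1 v = q v

variable {G : SimpleGraph (Fin n)} {α : ℝ} {q : Fin n → ℝ} {m : ℕ} {S D : ℕ → Fin n}

theorem Loaded.agree {s s' : Store} {p : Prog} (h : Loaded G α q m S D s) (ha : Agree p s s')
    (hi : ∀ a ∈ [0, 1, 2, 5, 6, 16], a ∉ p.intWrites)
    (hr : ∀ a ∈ [0, 1, 6], a ∉ p.realWrites) : Loaded G α q m S D s' := by
  simp only [List.forall_mem_cons, List.not_mem_nil, false_imp_iff, implies_true,
    and_true] at hi hr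
  obtain ⟨h0, h1, h2, h5, h6, h16⟩ := hi
  obtain ⟨r0, r1, r6⟩ := hr
  constructor
  · rw [ha.1 0 h0]; exact h.size
  · rw [ha.1 16 h16]; exact h.arcs
  · rw [ha.1 1 h1]; exact h.src
  · rw [ha.1 2 h2]; exact h.dst
  · rw [ha.1 5 h5]; exact h.rev
  · rw [ha.1 6 h6]; exact h.deg
  · rw [ha.2 0 r0]; exact h.alpha
  · rw [ha.2 6 r6]; exact h.link
  · rw [ha.2 1 r1]; exact h.jump

/-- Append the opposite of the edge `10`. -/
def doubleStep : Prog :=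
  .seq (.setInt 1 (.add (.get 0 (.const 1)) (.var 10)) (.get 2 (.var 10)))
    (.seq (.setInt 2 (.add (.get 0 (.const 1)) (.var 10)) (.get 1 (.var 10)))
      (.seq (.setInt 5 (.var 10) (.add (.get 0 (.const 1)) (.var 10)))
        (.setInt 5 (.add (.get 0 (.const 1)) (.var 10)) (.var 10))))

def doubleArcs : Prog := forLoop 10 (.get 0 (.const 1)) doubleStep

/-- Count the arc `10` at its target. -/
def degreeStep : Prog :=
  .setInt 6 (.get 2 (.var 10)) (.add (.get 6 (.get 2 (.var 10))) (.const 1))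

def countDegrees : Prog := forLoop 10 (.var 16) degreeStep

def loadGraph : Prog :=
  .seq doubleArcs
    (.seq (.setInt 16 (.const 0) (.add (.get 0 (.const 1)) (.get 0 (.const 1))))
      (.seq (.setReal 6 (.const 0) (.sub (.ofNat (.const 1)) (.var 0))) countDegrees))

theorem does_doubleArcs {s : Store} (hm : s.ints 0 1 = m)
    (hS : ∀ i < m, s.ints 1 i = S i) (hD : ∀ i < m, s.ints 2 i = D i)
    (hSD : ∀ i < m, S (m + i) = D i ∧ D (m + i) = S i) :
    Does doubleArcs s (100 * m + 100) fun s' =>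
      (∀ i < m + m, s'.ints 1 i = S i) ∧ (∀ i < m + m, s'.ints 2 i = D i) ∧
        ∀ i < m + m, s'.ints 5 i = revArc m i := by
  refine (Does.forLoop m (fun _ => 40)
    (fun j s' => (∀ i, i < m ∨ m ≤ i ∧ i < m + j → s'.ints 1 i = S i) ∧
      (∀ i, i < m ∨ m ≤ i ∧ i < m + j → s'.ints 2 i = D i) ∧
      ∀ i, i < j ∨ m ≤ i ∧ i < m + j → s'.ints 5 i = revArc m i)
    (by decide) ?_ ?_ ?_).mono ?_ ?_
  · intro s' h
    simp [NExpr.eval, h.1 0 (by decide), hm]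
  · refine ⟨fun i hi => ?_, fun i hi => ?_, fun i hi => ?_⟩
    · simpa using hS i (by omega)
    · simpa using hD i (by omega)
    · omega
  · rintro j s' hj ha hx ⟨h1, h2, h3⟩
    refine Does.of_run rfl (by decide) ?_
    have hm' : s'.ints 0 1 = m := by rw [ha.1 0 (by decide), hm]
    simp [doubleStep, Prog.run, NExpr.eval, hm', hx]
    -- When entry `j` of array `1` is read, its entry `m + j` has just been overwritten.
    have hmj : j ≠ m + j := by omega
    refine ⟨fun i hi => ?_, fun i hi => ?_, fun i hi => ?_⟩
    · rw [Function.update_apply]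
      split_ifs with h
      · rw [h, (hSD j hj).1]; exact h2 j (by omega)
      · exact h1 i (by omega)
    · rw [Function.update_apply]
      split_ifs with h
      · rw [h, (hSD j hj).2, Function.update_of_ne hmj]; exact h1 j (by omega)
      · exact h2 i (by omega)
    · rw [Function.update_apply, Function.update_apply]
      split_ifs with h h'
      · rw [h, revArc, if_neg (by omega)]; omega
      · rw [h', revArc, if_pos hj]
      · exact h3 i (by omega)
  · simp [NExpr.cost]; omega
  · rintro s' ha ⟨h1, h2, h3⟩
    exact ⟨fun i hi => h1 i (by omega), fun i hi => h2 i (by omega), fun i hi => h3 i (by omega)⟩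

theorem does_countDegrees {s : Store} {M : ℕ} (hM : s.ints 16 0 = M)
    (hD : ∀ i < M, s.ints 2 i = D i) (h0 : s.ints 6 = fun _ => 0) :
    Does countDegrees s (100 * M + 100) fun s' =>
      ∀ v : Fin n, s'.ints 6 v = (arcsInto D M v).card := by
  refine (Does.forLoop M (fun _ => 40)
    (fun j s' => ∀ v : Fin n, s'.ints 6 v = (arcsInto D j v).card)
    (by decide) ?_ ?_ ?_).mono ?_ ?_
  · intro s' h
    simp [NExpr.eval, h.1 16 (by decide), hM]
  · intro v
    simp [h0, arcsInto]
  · rintro j s' hj ha hx h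
    refine Does.of_run rfl (by decide) ?_
    intro v
    have hD' : s'.ints 2 j = D j := by rw [ha.1 2 (by decide), hD j hj]
    simp only [degreeStep, Prog.run, NExpr.eval, hx, hD', h]
    rw [Store.ints_setInt_of_ne _ _ _ (by decide), Store.ints_setInt_self, Function.update_apply,
      arcsInto_succ]
    by_cases hv : D j = v
    · simp [hv]
    · have hv' : (v : ℕ) ≠ (D j : ℕ) := fun h => hv (Fin.ext h.symm)
      simp [hv, hv', h]
  · simp [NExpr.cost]; omega
  · exact fun s' _ h => h

theorem does_loadGraph {es : List (Fin n × Fin n)} (hA : IsArcList G (es.length + es.length) S D)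
    (hes : ∀ i < es.length, es[i]? = some (S i, D i))
    (hSD : ∀ i < es.length, S (es.length + i) = D i ∧ D (es.length + i) = S i) :
    Does loadGraph (inputStore es α q) (300 * es.length + 300) (fun s =>
      Loaded G α q es.length S D s) := by
  refine Does.mono (Does.seq (T₂ := 200 * es.length + 200) ((does_doubleArcs (S := S) (D := D)
    (m := es.length) ?_ ?_ ?_ hSD).mono le_rfl ?_)) (by omega) fun _ _ h => h
  · simp [inputStore]
  · intro i hi
    simp [inputStore, hes i hi]
  · intro i hi
    simp [inputStore, hes i hi]
  rintro s ha ⟨h1, h2, h5⟩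
  refine Does.mono (Does.seq (T₁ := 10) (Does.of_run rfl (by decide)
    (Does.seq (T₁ := 10) (Does.of_run rfl (by decide)
      ((does_countDegrees (M := es.length + es.length) (D := D) ?_ ?_ ?_).mono le_rfl ?_)))))
      (by omega) fun _ _ h => h
  · simp [Prog.run, NExpr.eval, ha.1 0 (by decide), inputStore]
  · simpa [Prog.run, NExpr.eval] using h2
  · simp [Prog.run, NExpr.eval, ha.1 6 (by decide), inputStore]
  rintro s' ha' h6
  constructor
  · rw [ha'.1 0 (by decide)]
    simp [Prog.run, NExpr.eval, ha.1 0 (by decide), inputStore]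
  · rw [ha'.1 16 (by decide)]
    simp [Prog.run, NExpr.eval, ha.1 0 (by decide), inputStore]
  · rw [ha'.1 1 (by decide)]
    simpa [Prog.run, NExpr.eval] using h1
  · rw [ha'.1 2 (by decide)]
    simpa [Prog.run, NExpr.eval] using h2
  · rw [ha'.1 5 (by decide)]
    simpa [Prog.run, NExpr.eval] using h5
  · intro v
    rw [h6, hA.card_arcsInto]
  · rw [ha'.2 0 (by decide)]
    simp [Prog.run, ha.2 0 (by decide), inputStore]
  · rw [ha'.2 6 (by decide)]
    simp [Prog.run, RExpr.eval, NExpr.eval, ha.2 0 (by decide), inputStore]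
  · intro v
    rw [ha'.2 1 (by decide)]
    simp [Prog.run, ha.2 1 (by decide), inputStore]

end Load

/-! ### Passing messages -/

section Passing

variable {n : ℕ} {G : SimpleGraph (Fin n)} {α : ℝ} {q : Fin n → ℝ} {m : ℕ} {S D : ℕ → Fin n}
  {a b : Fin n → Fin n → ℝ}

/-- Recompute the messages along the arc `10`. -/
def passStep : Prog :=
  .seq (.setReal 12 (.const 0) (.div (.var 6) (.sub (.ofNat (.get 6 (.get 1 (.var 10))))
      (.mul (.var 6) (.sub (.get 4 (.get 1 (.var 10))) (.get 2 (.get 5 (.var 10))))))))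
    (.seq (.setReal 13 (.const 0) (.mul (.var 12) (.add (.mul (.var 0) (.get 1 (.get 1 (.var 10))))
        (.sub (.get 5 (.get 1 (.var 10))) (.get 3 (.get 5 (.var 10)))))))
      (.seq (.setReal 4 (.get 2 (.var 10)) (.add (.get 4 (.get 2 (.var 10)))
          (.sub (.var 12) (.get 2 (.var 10)))))
        (.seq (.setReal 5 (.get 2 (.var 10)) (.add (.get 5 (.get 2 (.var 10)))
            (.sub (.var 13) (.get 3 (.var 10)))))
          (.seq (.setReal 2 (.var 10) (.var 12)) (.setReal 3 (.var 10) (.var 13))))))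

def passMessages : Prog := forLoop 11 (.var 0) (forLoop 10 (.var 16) passStep)

/-- Real arrays `4` and `5` hold the sums of the messages by target. -/
def SumsStored (M : ℕ) (D : ℕ → Fin n) (s : Store) : Prop :=
  ∀ v : Fin n, s.reals 4 v = ∑ i ∈ arcsInto D M v, s.reals 2 i ∧
    s.reals 5 v = ∑ i ∈ arcsInto D M v, s.reals 3 i

/-- The messages along arc `i` are correct. -/
def MessageStored (S D : ℕ → Fin n) (a b : Fin n → Fin n → ℝ) (s : Store) (i : ℕ) : Prop :=
  s.reals 2 i = b (S i) (D i) ∧ s.reals 3 i = a (S i) (D i)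

/-- The messages and their sums are stored in memory. -/
structure Converged (G : SimpleGraph (Fin n)) (m : ℕ) (S D : ℕ → Fin n)
    (a b : Fin n → Fin n → ℝ) (s : Store) : Prop where
  messages : ∀ i < m + m, MessageStored S D a b s i
  sums_b : ∀ v : Fin n, s.reals 4 v = ∑ u ∈ nbrs G v, b u v
  sums_a : ∀ v : Fin n, s.reals 5 v = ∑ u ∈ nbrs G v, a u v

theorem Converged.agree {s s' : Store} {p : Prog} (h : Converged G m S D a b s)
    (ha : Agree p s s') (hr : ∀ a ∈ [2, 3, 4, 5], a ∉ p.realWrites) :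
    Converged G m S D a b s' := by
  simp only [List.forall_mem_cons, List.not_mem_nil, false_imp_iff, implies_true,
    and_true] at hr
  obtain ⟨r2, r3, r4, r5⟩ := hr
  constructor
  · intro i hi
    rw [MessageStored, ha.2 2 r2, ha.2 3 r3]
    exact h.messages i hi
  · rw [ha.2 4 r4]; exact h.sums_b
  · rw [ha.2 5 r5]; exact h.sums_a

/-- Leaving out one arc in the sum of the values of the arcs into `x`. -/
theorem IsArcList.sum_sub_eq {M : ℕ} (hA : IsArcList G M S D) {r : ℕ} (hr : r < M)
    {f : ℕ → ℝ} {g : Fin n → ℝ} (h : ∀ i < M, D i = D r → S i ≠ S r → f i = g (S i)) :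
    ∑ i ∈ arcsInto D M (D r), f i - f r = ∑ y ∈ (nbrs G (D r)).erase (S r), g y := by
  have h1 : ∑ i ∈ arcsInto D M (D r), f i =
      ∑ i ∈ arcsInto D M (D r), Function.update g (S r) (f r) (S i) := by
    refine Finset.sum_congr rfl fun i hi => ?_
    rw [mem_arcsInto] at hi
    rw [Function.update_apply]
    split_ifs with hS
    · rw [hA.inj i hi.1 r hr hS hi.2]
    · exact h i hi.1 hi.2 hS
  have hmem : S r ∈ nbrs G (D r) := mem_nbrs.2 (hA.adj r hr).symm
  rw [h1, hA.sum_arcsInto, ← Finset.add_sum_erase _ _ hmem, Function.update_self,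
    add_sub_cancel_left]
  exact Finset.sum_congr rfl fun y hy => Function.update_of_ne (Finset.ne_of_mem_erase hy) _ _

theorem revArc_spec (hSD : ∀ i < m, S (m + i) = D i ∧ D (m + i) = S i) {j : ℕ} (hj : j < m + m) :
    revArc m j < m + m ∧ S (revArc m j) = D j ∧ D (revArc m j) = S j := by
  rw [revArc]
  split_ifs with h
  · exact ⟨by omega, (hSD j h).1, (hSD j h).2⟩
  · have := hSD (j - m) (by omega)
    rw [Nat.add_sub_cancel' (by omega : m ≤ j)] at this
    exact ⟨by omega, this.2.symm, this.1.symm⟩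

/-- The stored sums belong to the current messages, correct or not. Subtracting whatever is stored
on the opposite arc leaves exactly the messages from the other neighbours, and their arcs have
smaller height. -/
theorem does_passStep (hG : G.IsAcyclic) (hA : IsArcList G (m + m) S D)
    (hSD : ∀ i < m, S (m + i) = D i ∧ D (m + i) = S i)
    (hm : IsMessage G (1 - α) (fun v => α * q v) a b) {s : Store} (hl : Loaded G α q m S D s)
    {j : ℕ} (hj : j < m + m) (hx : s.ints 10 0 = j) (hs : SumsStored (m + m) D s) :
    Does passStep s 200 fun s' => SumsStored (m + m) D s' ∧
      (∀ i, i ≠ j → MessageStored S D a b s i → MessageStored S D a b s' i) ∧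
      ((∀ i < m + m, height G (S i) (D i) < height G (S j) (D j) → MessageStored S D a b s i) →
        MessageStored S D a b s' j) := by
  obtain ⟨hr, hrS, hrD⟩ := revArc_spec hSD hj
  refine Does.of_run rfl (by decide) ?_
  simp only [passStep, Prog.run, NExpr.eval, RExpr.eval, Store.ints_setReal, hx, hl.src j hj,
    hl.dst j hj, hl.rev j hj, hl.deg]
  simp
  simp only [hl.link, hl.alpha, hl.jump]
  set nb := (1 - α) / ((nbrs G (S j)).card - (1 - α) * (s.reals 4 (S j) - s.reals 2 (revArc m j)))
    with hnb
  set na := nb * (α * q (S j) + (s.reals 5 (S j) - s.reals 3 (revArc m j))) with hna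
  refine ⟨fun v => ⟨?_, ?_⟩, ?_, ?_⟩
  · simp
    rw [sum_arcsInto_update D hj, ← (hs v).1, Function.update_apply]
    by_cases hv : D j = v
    · simp [hv]
    · have hv' : (v : ℕ) ≠ (D j : ℕ) := fun h => hv (Fin.ext h.symm)
      simp [hv, hv']
  · simp
    rw [sum_arcsInto_update D hj, ← (hs v).2, Function.update_apply]
    by_cases hv : D j = v
    · simp [hv]
    · have hv' : (v : ℕ) ≠ (D j : ℕ) := fun h => hv (Fin.ext h.symm)
      simp [hv, hv']
  · intro i hi h
    simpa [MessageStored, hi] using h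
  · intro hh
    have hin : ∀ i < m + m, D i = D (revArc m j) → S i ≠ S (revArc m j) →
        s.reals 2 i = b (S i) (S j) ∧ s.reals 3 i = a (S i) (S j) := by
      intro i hi h1 h2
      rw [hrD] at h1
      rw [hrS] at h2
      have h3 := hA.adj i hi
      have h4 := height_lt_height hG (hA.adj j hj) (h1 ▸ h3) h2
      have h5 := hh i hi (by rwa [h1])
      rwa [MessageStored, h1] at h5
    have hb := hA.sum_sub_eq hr (f := s.reals 2) (g := fun y => b y (S j))
      fun i hi h1 h2 => (hin i hi h1 h2).1
    have ha := hA.sum_sub_eq hr (f := s.reals 3) (g := fun y => a y (S j))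
      fun i hi h1 h2 => (hin i hi h1 h2).2
    rw [hrD, hrS] at hb ha
    rw [← (hs _).1] at hb
    rw [← (hs _).2] at ha
    have hb' : nb = b (S j) (D j) := by
      rw [hnb, hb, hm.b_eq _ _ (hA.adj j hj)]
    have ha' : na = a (S j) (D j) := by
      rw [hna, ha, hb', hm.a_eq _ _ (hA.adj j hj)]
    simp [MessageStored, ha', hb']

/-- After `r` passes, in whatever order the arcs are listed, all messages of height below `r` are
correct. All heights are below `n`. -/
theorem does_passMessages (hG : G.IsAcyclic) (hA : IsArcList G (m + m) S D)
    (hSD : ∀ i < m, S (m + i) = D i ∧ D (m + i) = S i)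
    (hm : IsMessage G (1 - α) (fun v => α * q v) a b) {s : Store} (hl : Loaded G α q m S D s)
    (h2 : s.reals 2 = fun _ => 0) (h3 : s.reals 3 = fun _ => 0) (h4 : s.reals 4 = fun _ => 0)
    (h5 : s.reals 5 = fun _ => 0) :
    Does passMessages s (n * (300 * (m + m) + 300) + 300) (Converged G m S D a b) := by
  refine (Does.forLoop n (fun _ => 250 * (m + m) + 200)
    (fun r s' => SumsStored (m + m) D s' ∧
      ∀ i < m + m, height G (S i) (D i) < r → MessageStored S D a b s' i)
    (by decide) ?_ ?_ ?_).mono ?_ ?_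
  · intro s' h
    simp [NExpr.eval, h.1 0 (by decide), hl.size]
  · refine ⟨fun v => ?_, fun i _ hi => absurd hi (Nat.not_lt_zero _)⟩
    simp [h2, h3, h4, h5]
  · rintro r s' - ha - ⟨hs, hr⟩
    have hl' := hl.agree ha (by decide) (by decide)
    refine (Does.forLoop (m + m) (fun _ => 200)
      -- Messages of height below `r` are recomputed to the same values. Those of height `r` become
      -- correct when their arc has been visited.
      (fun j s' => SumsStored (m + m) D s' ∧ ∀ i < m + m, height G (S i) (D i) < r ∨
        i < j ∧ height G (S i) (D i) < r + 1 → MessageStored S D a b s' i)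
      (by decide) ?_ ?_ ?_).mono ?_ ?_
    · intro s'' h
      simp [NExpr.eval, h.1 16 (by decide), hl'.arcs]
    · exact ⟨hs, fun i hi h => hr i hi (by omega)⟩
    · rintro j s'' hj ha' hx ⟨hs', hr'⟩
      refine (does_passStep (a := a) (b := b) hG hA hSD hm (hl'.agree ha' (by decide) (by decide))
        hj hx hs').mono le_rfl ?_
      rintro t - ⟨h1, h2, h3⟩
      refine ⟨h1, fun i hi h => ?_⟩
      by_cases hij : i = j
      · subst hij
        exact h3 fun i' hi' hlt => hr' i' hi' (by omega)
      · exact h2 i hij (hr' i hi (by omega))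
    · simp [NExpr.cost]; omega
    · rintro t - ⟨h1, h2⟩
      exact ⟨h1, fun i hi h => h2 i hi (by omega)⟩
  · simp only [NExpr.cost, Finset.sum_const, Finset.card_range, smul_eq_mul]
    have : n * (250 * (m + m) + 200 + (1 + 1) + 9) ≤ n * (300 * (m + m) + 300) :=
      Nat.mul_le_mul_left _ (by omega)
    omega
  · rintro t - ⟨h1, h2⟩
    have hst : ∀ i < m + m, MessageStored S D a b t i := fun i hi =>
      h2 i hi (by simpa using height_lt_card hG (hA.adj i hi))
    refine ⟨hst, fun v => ?_, fun v => ?_⟩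
    · rw [(h1 v).1, ← hA.sum_arcsInto v fun u => b u v]
      refine Finset.sum_congr rfl fun i hi => ?_
      rw [mem_arcsInto] at hi
      rw [(hst i hi.1).1, hi.2]
    · rw [(h1 v).2, ← hA.sum_arcsInto v fun u => a u v]
      refine Finset.sum_congr rfl fun i hi => ?_
      rw [mem_arcsInto] at hi
      rw [(hst i hi.1).2, hi.2]

end Passing

end PageRankGame

namespace PageRankGame

open RealRAM

/-! ### Testing the players -/

section Players

variable {n : ℕ} {G : SimpleGraph (Fin n)} {α : ℝ} {q : Fin n → ℝ} {m : ℕ} {S D : ℕ → Fin n}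
  {a b : Fin n → Fin n → ℝ} {v : Fin n}

/-- Collect the source of the arc `10` and its messages if its target is the current player. -/
def gatherStep : Prog :=
  .branch (.natEq (.get 2 (.var 10)) (.var 11))
    (.seq (.setInt 7 (.var 12) (.get 1 (.var 10)))
      (.seq (.setReal 9 (.get 1 (.var 10)) (.get 3 (.var 10)))
        (.seq (.setReal 10 (.get 1 (.var 10)) (.get 2 (.var 10)))
          (.setInt 12 (.const 0) (.add (.var 12) (.const 1))))))
    .skip

def gather : Prog := .seq (.setInt 12 (.const 0) (.const 0)) (forLoop 10 (.var 16) gatherStep)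

/-- Compute the PageRank of the current player. -/
def evaluate : Prog :=
  .seq (.setReal 7 (.const 0)
      (.div (.mul (.ofNat (.var 12)) (.add (.mul (.var 0) (.get 1 (.var 11))) (.get 5 (.var 11))))
        (.sub (.ofNat (.var 12)) (.mul (.var 6) (.get 4 (.var 11))))))
    (.seq (.setReal 8 (.const 0) (.mul (.var 7) (.var 6)))
      (.setReal 14 (.const 0) (.sub (.var 7) (.mul (.var 0) (.get 1 (.var 11))))))

def sumKeys : Prog :=
  .seq (.setReal 11 (.const 0) (.ofNat (.const 0)))
    (forLoop 10 (.add (.var 13) (.const 1))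
      (.setReal 11 (.const 0) (.add (.var 11) (keyAt (.get 7 (.var 10))))))

/-- Output the current player and the first neighbours of the order. -/
def report : Prog :=
  .seq (.setInt 3 (.const 0) (.const 0))
    (.seq (.setInt 3 (.const 1) (.var 11))
      (forLoop 10 (.add (.var 13) (.const 1)) (.setInt 4 (.get 7 (.var 10)) (.const 1))))

/-- Test the best strategy of the size of the current round. -/
def testBest : Prog :=
  .seq sumKeys
    (.branch (.and (.realLt (.mul (.ofNat (.add (.var 13) (.const 1))) (.var 14)) (.var 11))
        -- Only the first improving strategy is reported: `report` relies on array `4` being zero,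
        -- and a second report would mix two strategies.
        (.natEq (.get 3 (.const 0)) (.const 1)))
      report .skip)

def rounds : Prog := forLoop 13 (.var 12) (.seq gnomeSort testBest)

def testPlayer : Prog := .seq gather (.seq evaluate rounds)

def testPlayers : Prog := forLoop 11 (.var 0) testPlayer

/-- An improving strategy has been reported. -/
def Found (G : SimpleGraph (Fin n)) (α : ℝ) (q : Fin n → ℝ) (s : Store) : Prop :=
  answer s = 0 ∧ ∃ v : Fin n, outPlayer s = v ∧ IsImproving G α q v (outStrategy n s)

/-- No improving strategy has been reported yet. -/
def Pending (s : Store) : Prop := answer s = 1 ∧ s.ints 4 = fun _ => 0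

theorem Found.agree {s s' : Store} {p : Prog} (h : Found G α q s) (ha : Agree p s s')
    (hi : ∀ a ∈ [3, 4], a ∉ p.intWrites) : Found G α q s' := by
  simp only [List.forall_mem_cons, List.not_mem_nil, false_imp_iff, implies_true,
    and_true] at hi
  rw [Found, answer, outPlayer, outStrategy, ha.1 3 hi.1, ha.1 4 hi.2]
  exact h

theorem Pending.agree {s s' : Store} {p : Prog} (h : Pending s) (ha : Agree p s s')
    (hi : ∀ a ∈ [3, 4], a ∉ p.intWrites) : Pending s' := by
  simp only [List.forall_mem_cons, List.not_mem_nil, false_imp_iff, implies_true,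
    and_true] at hi
  rw [Pending, answer, ha.1 3 hi.1, ha.1 4 hi.2]
  exact h

/-- The data of player `v` are stored in memory. -/
structure Ready (G : SimpleGraph (Fin n)) (α : ℝ) (q : Fin n → ℝ) (a b : Fin n → Fin n → ℝ)
    (v : Fin n) (s : Store) : Prop where
  player : s.ints 11 0 = v
  count : s.ints 12 0 = (nbrs G v).card
  message_a : ∀ u ∈ nbrs G v, s.reals 9 u = a u v
  message_b : ∀ u ∈ nbrs G v, s.reals 10 u = b u v
  -- For an isolated player the computed quotient is meaningless, but she has no strategy and no
  -- round is run.
  price : (nbrs G v).Nonempty → s.reals 8 0 = pageRank G α q v * (1 - α)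
  threshold : (nbrs G v).Nonempty → s.reals 14 0 = pageRank G α q v - α * q v

theorem Ready.agree {s s' : Store} {p : Prog} (h : Ready G α q a b v s) (ha : Agree p s s')
    (hi : ∀ a ∈ [11, 12], a ∉ p.intWrites) (hr : ∀ a ∈ [8, 9, 10, 14], a ∉ p.realWrites) :
    Ready G α q a b v s' := by
  simp only [List.forall_mem_cons, List.not_mem_nil, false_imp_iff, implies_true,
    and_true] at hi hr
  obtain ⟨i11, i12⟩ := hi
  obtain ⟨r8, r9, r10, r14⟩ := hr
  constructor
  · rw [ha.1 11 i11]; exact h.player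
  · rw [ha.1 12 i12]; exact h.count
  · rw [ha.2 9 r9]; exact h.message_a
  · rw [ha.2 10 r10]; exact h.message_b
  · rw [ha.2 8 r8]; exact h.price
  · rw [ha.2 14 r14]; exact h.threshold

/-- Integer array `7` lists the neighbours of `v`. -/
def Ordered (G : SimpleGraph (Fin n)) (v : Fin n) (s : Store) : Prop :=
  Set.BijOn (s.ints 7) (Set.Iio (nbrs G v).card) {u | ∃ w ∈ nbrs G v, (w : ℕ) = u}

theorem bijOn_update_insert {d x : ℕ} {σ : ℕ → ℕ} {X : Set ℕ} (h : Set.BijOn σ (Set.Iio d) X)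
    (hx : x ∉ X) : Set.BijOn (Function.update σ d x) (Set.Iio (d + 1)) (insert x X) := by
  have h1 : Set.Iio (d + 1) = insert d (Set.Iio d) := by
    ext i
    simp only [Set.mem_Iio, Set.mem_insert_iff]
    omega
  have h2 : Set.BijOn (Function.update σ d x) (Set.Iio d) X :=
    h.congr fun i hi => (Function.update_of_ne (Set.mem_Iio.1 hi).ne _ _).symm
  have h3 := h2.insert (a := d) (by rwa [Function.update_self])
  rwa [Function.update_self, ← h1] at h3

/-- Real arrays `9` and `10` are not cleared between players. Only their entries at neighbours of
`v` are ever read, and these are fresh. -/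
theorem does_gather (hA : IsArcList G (m + m) S D) {s : Store} (hl : Loaded G α q m S D s)
    (hc : Converged G m S D a b s) (hv : s.ints 11 0 = v) :
    Does gather s (100 * (m + m) + 100) fun s' => s'.ints 12 0 = (nbrs G v).card ∧
      Ordered G v s' ∧ ∀ u ∈ nbrs G v, s'.reals 9 u = a u v ∧ s'.reals 10 u = b u v := by
  refine Does.mono (Does.seq (T₁ := 10) (Does.of_run rfl (by decide) ((Does.forLoop (m + m)
    (fun _ => 50)
    (fun i s' => (s'.ints 12 0 = (arcsInto D i v).card ∧
      Set.BijOn (s'.ints 7) (Set.Iio (arcsInto D i v).card)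
        {u | ∃ j ∈ arcsInto D i v, (S j : ℕ) = u}) ∧
      ∀ j ∈ arcsInto D i v, s'.reals 9 (S j) = a (S j) v ∧ s'.reals 10 (S j) = b (S j) v)
    (by decide) ?_ ?_ ?_).mono le_rfl ?_))) ?_ fun _ _ h => h
  · intro s' h
    simp [Prog.run, NExpr.eval, h.1 16 (by decide), hl.arcs]
  · simp [Prog.run, NExpr.eval, arcsInto, Set.BijOn, Set.SurjOn, Set.MapsTo]
  · rintro i s' hi ha hx ⟨⟨h12, h7⟩, h9⟩
    refine Does.of_run rfl (by decide) ?_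
    have hl' : Loaded G α q m S D s' := by
      refine Loaded.agree (Loaded.agree (p := .setInt 12 (.const 0) (.const 0)) hl
        (Exec.setInt s 12 (.const 0) (.const 0)).agree ?_ ?_) ha ?_ ?_ <;> decide
    have hc' : Converged G m S D a b s' := by
      refine Converged.agree (Converged.agree (p := .setInt 12 (.const 0) (.const 0)) hc
        (Exec.setInt s 12 (.const 0) (.const 0)).agree ?_) ha ?_ <;> decide
    have hv' : s'.ints 11 0 = v := by
      rw [ha.1 11 (by decide)]
      simpa [Prog.run, NExpr.eval] using hv
    have hins : D i = v → ∀ j, j ∈ arcsInto D (i + 1) v ↔ j = i ∨ j ∈ arcsInto D i v := by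
      intro h j
      rw [mem_arcsInto, mem_arcsInto]
      constructor
      · rintro ⟨h1, h2⟩
        by_cases hji : j = i
        · exact Or.inl hji
        · exact Or.inr ⟨by omega, h2⟩
      · rintro (rfl | ⟨h1, h2⟩)
        · exact ⟨by omega, h⟩
        · exact ⟨by omega, h2⟩
    by_cases hD : D i = v
    · rw [gatherStep, Prog.run, if_pos (by
        simp [Cond.Holds, NExpr.eval, hx, hl'.dst i hi, hv', hD])]
      simp only [Prog.run, NExpr.eval, RExpr.eval, Store.ints_setReal]
      simp [hx, hl'.src i hi, h12]
      have hcard : (arcsInto D (i + 1) v).card = (arcsInto D i v).card + 1 := by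
        rw [arcsInto_succ, if_pos hD]
      have hmsg := hc'.messages i hi
      rw [MessageStored, hD] at hmsg
      refine ⟨⟨hcard.symm, ?_⟩, ?_⟩
      · have hset : {u | ∃ j ∈ arcsInto D (i + 1) v, (S j : ℕ) = u} =
            insert (S i : ℕ) {u | ∃ j ∈ arcsInto D i v, (S j : ℕ) = u} := by
          ext u
          simp only [hins hD, Set.mem_insert_iff]
          constructor
          · rintro ⟨j, rfl | hj, rfl⟩
            · exact Or.inl rfl
            · exact Or.inr ⟨j, hj, rfl⟩
          · rintro (rfl | ⟨j, hj, rfl⟩)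
            · exact ⟨i, Or.inl rfl, rfl⟩
            · exact ⟨j, Or.inr hj, rfl⟩
        rw [hset, hcard]
        refine bijOn_update_insert h7 ?_
        rintro ⟨j, hj, hji⟩
        rw [mem_arcsInto] at hj
        have := hA.inj j (by omega) i hi (Fin.ext hji) (hj.2.trans hD.symm)
        omega
      · intro j hj
        rcases (hins hD j).1 hj with rfl | hj
        · simp [hmsg.1, hmsg.2]
        · simp only [Function.update_apply]
          split_ifs with h
          · rw [Fin.ext h]
            exact ⟨hmsg.2, hmsg.1⟩
          · exact h9 j hj
    · rw [gatherStep, Prog.run, if_neg (by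
        simp only [Cond.Holds, NExpr.eval, hx, hl'.dst i hi, hv']
        exact fun h => hD (Fin.ext h))]
      have heq : arcsInto D (i + 1) v = arcsInto D i v := by
        ext j
        rw [mem_arcsInto, mem_arcsInto]
        refine ⟨fun h => ⟨?_, h.2⟩, fun h => ⟨by omega, h.2⟩⟩
        have : j ≠ i := by rintro rfl; exact hD h.2
        omega
      rw [heq]
      simpa [Prog.run] using ⟨⟨h12, h7⟩, h9⟩
  · rintro s' - ⟨⟨h12, h7⟩, h9⟩
    rw [hA.card_arcsInto] at h12 h7
    have hmem : ∀ u, u ∈ nbrs G v ↔ ∃ j ∈ arcsInto D (m + m) v, S j = u := by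
      intro u
      rw [mem_nbrs]
      constructor
      · intro h
        obtain ⟨j, hj, h1, h2⟩ := hA.surj u v h.symm
        exact ⟨j, mem_arcsInto.2 ⟨hj, h2⟩, h1⟩
      · rintro ⟨j, hj, rfl⟩
        rw [mem_arcsInto] at hj
        rw [← hj.2]
        exact (hA.adj j hj.1).symm
    refine ⟨h12, ?_, ?_⟩
    · rw [Ordered]
      convert h7 using 1
      ext u
      simp [hmem]
    · intro u hu
      obtain ⟨j, hj, rfl⟩ := (hmem u).1 hu
      exact h9 j hj
  · simp [NExpr.cost]; omega

theorem does_evaluate (hG : G.IsAcyclic) (h0 : 0 < α) (h1 : α < 1) (hq : IsDistribution q)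
    (hm : IsMessage G (1 - α) (fun v => α * q v) a b) {s : Store} (hl : Loaded G α q m S D s)
    (hc : Converged G m S D a b s) (hv : s.ints 11 0 = v)
    (hd : s.ints 12 0 = (nbrs G v).card)
    (hmsg : ∀ u ∈ nbrs G v, s.reals 9 u = a u v ∧ s.reals 10 u = b u v) :
    Does evaluate s 100 (Ready G α q a b v) := by
  refine Does.of_run rfl (by decide) ?_
  have hpr := fun h => pageRank_eq hG h0 h1 hq hm (v := v) h
  constructor
  · simpa [evaluate, Prog.run] using hv
  · simpa [evaluate, Prog.run] using hd
  · simpa [evaluate, Prog.run] using fun u hu => (hmsg u hu).1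
  · simpa [evaluate, Prog.run] using fun u hu => (hmsg u hu).2
  · intro h
    simp [evaluate, Prog.run, RExpr.eval, NExpr.eval, hv, hd, hl.alpha, hl.link, hl.jump,
      hc.sums_a, hc.sums_b, hpr h]
  · intro h
    simp [evaluate, Prog.run, RExpr.eval, NExpr.eval, hv, hd, hl.alpha, hl.link, hl.jump,
      hc.sums_a, hc.sums_b, hpr h]

theorem does_sumKeys (s : Store) : Does sumKeys s (100 * (s.ints 13 0 + 1) + 100) fun s' =>
    s'.reals 11 0 = ∑ i ∈ Finset.range (s.ints 13 0 + 1), key s (s.ints 7 i) := by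
  refine Does.mono (Does.seq (T₁ := 10) (Does.of_run rfl (by decide)
    (Does.forLoop (s.ints 13 0 + 1) (fun _ => 50)
    (fun j s' => s'.reals 11 0 = ∑ i ∈ Finset.range j, key s (s.ints 7 i))
    (by decide) ?_ ?_ ?_))) ?_ fun _ _ h => h
  · intro s' h
    simp [Prog.run, NExpr.eval, h.1 13 (by decide)]
  · simp [Prog.run, RExpr.eval, NExpr.eval]
  · intro j s' hj ha hx h
    refine Does.of_run rfl (by decide) ?_
    have hk : key s' = key s := by
      funext u
      simp [key, ha.1 13 (by decide), ha.2 9 (by decide), ha.2 8 (by decide),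
        ha.2 10 (by decide), Prog.run]
    have h7 : s'.ints 7 = s.ints 7 := by simp [ha.1 7 (by decide), Prog.run]
    simp [Prog.run, RExpr.eval, NExpr.eval, eval_keyAt, hx, hk, h7, h, Finset.sum_range_succ]
  · simp [NExpr.cost]; omega

theorem does_report {s : Store} (h4 : s.ints 4 = fun _ => 0) :
    Does report s (100 * (s.ints 13 0 + 1) + 100) fun s' =>
      answer s' = 0 ∧ outPlayer s' = s.ints 11 0 ∧
        ∀ u, s'.ints 4 u = 1 ↔ u ∈ (Finset.range (s.ints 13 0 + 1)).image (s.ints 7) := by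
  refine Does.mono (Does.seq (T₁ := 10) (Does.of_run rfl (by decide) (Does.seq (T₁ := 10)
    (Does.of_run rfl (by decide) ((Does.forLoop (s.ints 13 0 + 1) (fun _ => 50)
    (fun j s' => ∀ u, s'.ints 4 u = 1 ↔ u ∈ (Finset.range j).image (s.ints 7))
    (by decide) ?_ ?_ ?_).mono le_rfl ?_))))) ?_ fun _ _ h => h
  · intro s' h
    simp [Prog.run, NExpr.eval, h.1 13 (by decide)]
  · simp [Prog.run, h4]
  · intro j s' hj ha hx h
    refine Does.of_run rfl (by decide) ?_
    have h7 : s'.ints 7 = s.ints 7 := by simp [ha.1 7 (by decide), Prog.run]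
    intro u
    rw [Finset.range_add_one, Finset.image_insert, Finset.mem_insert, ← h]
    simp [Prog.run, NExpr.eval, hx, h7, Function.update_apply]
    tauto
  · intro s' ha h
    refine ⟨?_, ?_, h⟩
    · rw [answer, ha.1 3 (by decide)]
      simp [Prog.run, NExpr.eval]
    · rw [outPlayer, ha.1 3 (by decide)]
      simp [Prog.run, NExpr.eval]
  · simp [NExpr.cost]; omega

/-- The first `k + 1` neighbours in the order maximise the left-hand side of the criterion among
sets of this size. If they fail the test, so does every other such set. -/
theorem does_testBest (hG : G.IsAcyclic) (h0 : 0 < α) (h1 : α < 1) (hq : IsDistribution q)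
    (hm : IsMessage G (1 - α) (fun v => α * q v) a b) {s : Store} (hr : Ready G α q a b v s)
    (ho : Ordered G v s) (hfp : Found G α q s ∨ Pending s) {k : ℕ}
    (hk : s.ints 13 0 = k) (hkd : k < (nbrs G v).card)
    (hs : ∀ i, i + 1 < (nbrs G v).card → key s (s.ints 7 (i + 1)) ≤ key s (s.ints 7 i)) :
    Does testBest s (300 * (k + 1) + 300) fun s' =>
      (Found G α q s → Found G α q s') ∧ (Pending s → Found G α q s' ∨ Pending s' ∧
        ∀ E ⊆ nbrs G v, E.card = k + 1 → ¬ IsImproving G α q v E) := by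
  have hne : (nbrs G v).Nonempty := Finset.card_pos.1 (by omega)
  have hkey : ∀ w ∈ nbrs G v, key s w =
      gain ((k + 1 : ℕ) : ℝ) (pageRank G α q v * (1 - α)) a b v w := by
    intro w hw
    rw [key, gain, hr.message_a w hw, hr.message_b w hw, hr.price hne, hk]
  have himp : ∀ E ⊆ nbrs G v, E.card = k + 1 → (IsImproving G α q v E ↔
      ((k + 1 : ℕ) : ℝ) * s.reals 14 0 < ∑ w ∈ E, key s w) := by
    intro E hE hc
    rw [isImproving_iff hG h0 h1 hq hm hE (Finset.card_pos.1 (by omega)), hr.threshold hne, hc,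
      Finset.sum_congr rfl fun w hw => hkey w (hE hw)]
  refine Does.mono (Does.seq (T₂ := 100 * (k + 1) + 150) ((does_sumKeys s).mono le_rfl ?_))
    (by omega) fun _ _ h => h
  intro s₁ ha₁ hsum
  rw [hk] at hsum
  have hcond : (Cond.and (.realLt (.mul (.ofNat (.add (.var 13) (.const 1)))
      (.var 14)) (.var 11)) (.natEq (.get 3 (.const 0)) (.const 1))).Holds s₁ ↔
      ((k + 1 : ℕ) : ℝ) * s.reals 14 0 < ∑ i ∈ Finset.range (k + 1), key s (s.ints 7 i) ∧
        answer s = 1 := by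
    simp only [Cond.Holds, RExpr.eval, NExpr.eval, hsum, ha₁.1 13 (by decide), hk,
      ha₁.2 14 (by decide), ha₁.1 3 (by decide), answer]
  refine Does.mono (Does.branch (T := 100 * (k + 1) + 120) ?_ ?_)
    (by simp [Cond.cost, RExpr.cost, NExpr.cost]; omega) fun _ _ h => h
  · intro hb
    obtain ⟨hlt, hans⟩ := (hcond).1 hb
    have hp : Pending s := hfp.resolve_left fun hf => by
      rw [hf.1] at hans
      exact absurd hans zero_ne_one
    have hp₁ := hp.agree ha₁ (by decide)
    refine (does_report hp₁.2).mono ?_ ?_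
    · rw [ha₁.1 13 (by decide), hk]; omega
    rintro s₂ ha₂ ⟨hans₂, hpl, hout⟩
    rw [ha₁.1 13 (by decide), hk, ha₁.1 7 (by decide)] at hout
    rw [ha₁.1 11 (by decide), hr.player] at hpl
    have hf : Found G α q s₂ := by
      refine ⟨hans₂, v, hpl, ?_⟩
      -- The reported strategy as a set of vertices: those whose numbers occupy the first `k + 1`
      -- positions.
      set E : Finset (Fin n) := Finset.univ.filter fun w =>
        (w : ℕ) ∈ (Finset.range (k + 1)).image (s.ints 7) with hE
      have hmemE : ∀ i ∈ Finset.range (k + 1), ∃ w ∈ nbrs G v, (w : ℕ) = s.ints 7 i :=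
        fun i hi => ho.mapsTo (by rw [Finset.mem_range] at hi; rw [Set.mem_Iio]; omega)
      have hinj : Set.InjOn (s.ints 7) (Finset.range (k + 1)) := ho.injOn.mono fun i hi => by
        rw [Finset.mem_coe, Finset.mem_range] at hi
        rw [Set.mem_Iio]
        omega
      have hmap : E.map Fin.valEmbedding = (Finset.range (k + 1)).image (s.ints 7) := by
        ext u
        simp only [Finset.mem_map, hE, Finset.mem_filter, Finset.mem_univ, true_and,
          Fin.valEmbedding_apply]
        constructor
        · rintro ⟨w, hw, rfl⟩
          exact hw
        · intro hu
          obtain ⟨i, hi, rfl⟩ := Finset.mem_image.1 hu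
          obtain ⟨w, -, hw⟩ := hmemE i hi
          exact ⟨w, hw ▸ hu, hw⟩
      have hsub : E ⊆ nbrs G v := by
        intro w hw
        obtain ⟨i, hi, hiw⟩ := Finset.mem_image.1 (Finset.mem_filter.1 hw).2
        obtain ⟨w', hw', h⟩ := hmemE i hi
        rwa [← Fin.ext (h.trans hiw)]
      have hcardE : E.card = k + 1 := by
        rw [← Finset.card_map Fin.valEmbedding, hmap, Finset.card_image_of_injOn hinj,
          Finset.card_range]
      have hsumE : ∑ w ∈ E, key s w = ∑ i ∈ Finset.range (k + 1), key s (s.ints 7 i) := by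
        rw [← Finset.sum_image (f := key s) hinj, ← hmap, Finset.sum_map]
        rfl
      have hset : outStrategy n s₂ = (E : Set (Fin n)) := by
        ext w
        simp only [outStrategy, Set.mem_ofPred_eq, hout, hE, Finset.coe_filter, Finset.mem_univ,
          true_and]
      rw [hset, himp E hsub hcardE, hsumE]
      exact hlt
    exact ⟨fun _ => hf, fun _ => Or.inl hf⟩
  · intro hb
    rw [hcond] at hb
    refine Does.of_run rfl (by simp [Prog.maxCost]) ?_
    rw [Prog.run]
    refine ⟨fun h => h.agree ha₁ (by decide), fun hp => Or.inr ⟨hp.agree ha₁ (by decide), ?_⟩⟩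
    intro E hE hc hi
    rw [himp E hE hc] at hi
    refine hb ⟨hi.trans_le ?_, hp.1⟩
    have := sum_le_sum_range_of_bijOn ho hs (E := E.map Fin.valEmbedding) (by
      intro u hu
      obtain ⟨w, hw, rfl⟩ := Finset.mem_map.1 hu
      exact ⟨w, hE hw, rfl⟩)
    rwa [Finset.sum_map, Finset.card_map, hc] at this

theorem isBestResponse_of_forall (h : ∀ E ⊆ nbrs G v, E.Nonempty → ¬ IsImproving G α q v E) :
    IsBestResponse G α q v := by
  classical
  intro E hE
  have hE' : ((Set.toFinite E).toFinset : Set (Fin n)) = E := Set.Finite.coe_toFinset _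
  have := h (Set.toFinite E).toFinset
    (fun w hw => mem_nbrs.2 (hE.1 ((Set.Finite.mem_toFinset _).1 hw)))
    (by rw [← Finset.coe_nonempty, hE']; exact hE.2)
  rw [hE', IsImproving, not_and] at this
  exact not_lt.1 (this hE)

/-- The list left by one round is the start of the next. Only the first round may need quadratic
time for an arbitrary order; later exchanges are charged to inversions with respect to the messages
`a`, which never increase in number. -/
theorem does_rounds (hG : G.IsAcyclic) (h0 : 0 < α) (h1 : α < 1) (hq : IsDistribution q)
    (hm : IsMessage G (1 - α) (fun v => α * q v) a b) {s : Store} (hr : Ready G α q a b v s)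
    (ho : Ordered G v s) (hfp : Found G α q s ∨ Pending s) :
    Does rounds s (1500 * ((nbrs G v).card * (nbrs G v).card) + 1500 * (nbrs G v).card + 100)
      fun s' => (Found G α q s → Found G α q s') ∧
        (Pending s → Found G α q s' ∨ Pending s' ∧ IsBestResponse G α q v) := by
  set d := (nbrs G v).card with hd
  obtain ⟨t, s', hex, ht, hI⟩ := exists_exec_forLoop (x := 13) (e := .var 12)
    (p := .seq gnomeSort testBest) (s := s) (N := d)
    (fun k s' => Ordered G v s' ∧
      -- Round `k` sorts with factor `k + 1`. Before the first round nothing is known about the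
      -- order.
      (0 < k → ∀ i, i + 1 < d →
        (k : ℝ) * s.reals 9 (s'.ints 7 (i + 1)) + s.reals 8 0 * s.reals 10 (s'.ints 7 (i + 1)) ≤
        (k : ℝ) * s.reals 9 (s'.ints 7 i) + s.reals 8 0 * s.reals 10 (s'.ints 7 i)) ∧
      (Found G α q s → Found G α q s') ∧ (Pending s → Found G α q s' ∨ Pending s' ∧
        ∀ E ⊆ nbrs G v, E.Nonempty → E.card ≤ k → ¬ IsImproving G α q v E))
    -- The linear part pays for scanning and testing in each round. Of the initial `400 * (d * d)`,
    -- one half pays for the exchanges of the first round and the other half funds the inversions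
    -- with respect to `a` that it leaves behind.
    (fun k s' => (d - k) * (400 * d + 1000) +
      if k = 0 then 400 * (d * d) else 200 * (inversions d (s.reals 9) (s'.ints 7)).card)
    (by decide) (fun s' h => by simp [NExpr.eval, h.1 12 (by decide), hr.count, hd]) (by
      refine ⟨by simpa [Ordered] using ho, by simp, fun h => ?_, fun h => Or.inr ⟨?_, ?_⟩⟩
      · exact h.agree (p := .setInt 13 (.const 0) (.const 0))
          (Exec.setInt s 13 (.const 0) (.const 0)).agree (by decide)
      · exact h.agree (p := .setInt 13 (.const 0) (.const 0))
          (Exec.setInt s 13 (.const 0) (.const 0)).agree (by decide)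
      · intro E _ hne hc
        exact absurd (Finset.card_pos.2 hne) (by omega)) (by
      rintro k s₁ hk ha hx ⟨ho₁, hs₁, hf₁, hp₁⟩
      have hr₁ : Ready G α q a b v s₁ := hr.agree ha (by decide) (by decide)
      have hkey : ∀ u, key s₁ u = ((k + 1 : ℕ) : ℝ) * s.reals 9 u + s.reals 8 0 * s.reals 10 u := by
        intro u
        rw [key, hx, ha.2 9 (by decide), ha.2 8 (by decide), ha.2 10 (by decide)]
      obtain ⟨t₁, s₂, hex₁, ho₂, hs₂, ht₁⟩ : ∃ t₁ s₂, Exec gnomeSort s₁ t₁ s₂ ∧ Ordered G v s₂ ∧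
          (∀ i, i + 1 < d → key s₁ (s₂.ints 7 (i + 1)) ≤ key s₁ (s₂.ints 7 i)) ∧
          t₁ + 200 * (inversions d (s.reals 9) (s₂.ints 7)).card ≤ 100 * d + 100 +
            if k = 0 then 400 * (d * d)
              else 200 * (inversions d (s.reals 9) (s₁.ints 7)).card := by
        rcases Nat.eq_zero_or_pos k with hk0 | hk0
        · obtain ⟨t₁, s₂, e1, e2, e3, e4⟩ := exists_exec_gnomeSort s₁ (key s₁) hr₁.count ho₁
            fun i j _ _ h => h
          refine ⟨t₁, s₂, e1, e2, e3, ?_⟩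
          rw [if_pos hk0]
          have i1 := card_inversions_le d (s.reals 9) (s₂.ints 7)
          have i2 := card_inversions_le d (key s₁) (s₁.ints 7)
          rw [← hd] at e4
          omega
        · obtain ⟨t₁, s₂, e1, e2, e3, e4⟩ := exists_exec_gnomeSort s₁ (s.reals 9) hr₁.count ho₁ (by
            intro i j hij hj h
            -- The order for factor `k` is right and that for `k + 1` is wrong. Subtracting the two
            -- inequalities shows that the pair is out of order with respect to `a`.
            have := antitone_of_step (h := fun i => (k : ℝ) * s.reals 9 (s₁.ints 7 i) +
              s.reals 8 0 * s.reals 10 (s₁.ints 7 i)) (hs₁ hk0) i j hij.le hj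
            rw [hkey, hkey] at h
            push_cast at h
            linarith)
          refine ⟨t₁, s₂, e1, e2, e3, ?_⟩
          rw [if_neg hk0.ne']
          rw [← hd] at e4
          omega
      have ha₁ := hex₁.agree
      have hkey₂ : key s₂ = key s₁ := by
        funext u
        rw [key, key, ha₁.1 13 (by decide), ha₁.2 9 (by decide), ha₁.2 8 (by decide),
          ha₁.2 10 (by decide)]
      have hfp₂ : Found G α q s₂ ∨ Pending s₂ := by
        have : Found G α q s₁ ∨ Pending s₁ := hfp.elim (fun h => Or.inl (hf₁ h))
          fun h => (hp₁ h).imp id And.left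
        exact this.imp (fun h => h.agree ha₁ (by decide)) fun h => h.agree ha₁ (by decide)
      obtain ⟨t₂, s₃, hex₂, ht₂, hf₃, hp₃⟩ := does_testBest hG h0 h1 hq hm
        (hr₁.agree ha₁ (by decide) (by decide)) ho₂ hfp₂ (k := k)
        (by rw [ha₁.1 13 (by decide), hx]) hk (by rwa [hkey₂])
      have ha₂ := hex₂.agree
      have h7 : s₃.ints 7 = s₂.ints 7 := ha₂.1 7 (by decide)
      have hset : ∀ s' : Store, Agree (.setInt 13 (.const 0) (.const (k + 1))) s'
          (s'.setInt 13 0 (k + 1)) :=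
        fun s' => (Exec.setInt s' 13 (.const 0) (.const (k + 1))).agree
      refine ⟨_, s₃, hex₁.seq hex₂, ⟨?_, ?_, ?_, ?_⟩, ?_⟩
      · simpa [Ordered, h7] using ho₂
      · intro _ i hi
        have := hs₂ i hi
        rw [hkey, hkey] at this
        simpa [h7] using this
      · intro h
        exact (hf₃ ((hf₁ h).agree ha₁ (by decide))).agree (hset s₃)
          (by simp [Prog.intWrites])
      · intro h
        rcases hp₁ h with h | ⟨h, hE⟩
        · exact Or.inl ((hf₃ (h.agree ha₁ (by decide))).agree (hset s₃)
            (by simp [Prog.intWrites]))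
        · refine (hp₃ (h.agree ha₁ (by decide))).imp
            (fun h => h.agree (hset s₃) (by simp [Prog.intWrites]))
            fun h => ⟨h.1.agree (hset s₃) (by simp [Prog.intWrites]), fun E hEs hne hc => ?_⟩
          rcases Nat.lt_or_eq_of_le hc with hc | hc
          · exact hE E hEs hne (by omega)
          · exact h.2 E hEs hc
      · obtain ⟨c, hc⟩ : ∃ c, d - k = c + 1 := ⟨d - k - 1, by omega⟩
        have hc' : d - (k + 1) = c := by omega
        rw [hc, hc', if_neg (Nat.succ_ne_zero k), Store.ints_setInt_of_ne _ _ _ (by decide), h7,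
          add_one_mul]
        simp only [NExpr.cost]
        omega)
  refine ⟨t, s', hex, ?_, hI.2.2.1, fun h => (hI.2.2.2 h).imp id fun h => ⟨h.1, ?_⟩⟩
  · simp only [Nat.sub_zero, if_true, NExpr.cost] at ht
    have : d * (400 * d + 1000) = 400 * (d * d) + 1000 * d := by ring
    omega
  · exact isBestResponse_of_forall fun E hE hne => h.2 E hE hne (Finset.card_le_card hE)

theorem does_testPlayer (hG : G.IsAcyclic) (h0 : 0 < α) (h1 : α < 1) (hq : IsDistribution q)
    (hm : IsMessage G (1 - α) (fun v => α * q v) a b) (hA : IsArcList G (m + m) S D)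
    {s : Store} (hl : Loaded G α q m S D s) (hc : Converged G m S D a b s)
    (hv : s.ints 11 0 = v) (hfp : Found G α q s ∨ Pending s) :
    Does testPlayer s (1500 * ((nbrs G v).card * (nbrs G v).card) + 1500 * (nbrs G v).card +
      100 * (m + m) + 300) fun s' => (Found G α q s → Found G α q s') ∧
        (Pending s → Found G α q s' ∨ Pending s' ∧ IsBestResponse G α q v) := by
  refine Does.mono (Does.seq
    (T₂ := 1500 * ((nbrs G v).card * (nbrs G v).card) + 1500 * (nbrs G v).card + 200)
    ((does_gather hA hl hc hv).mono le_rfl ?_)) ?_ fun _ _ h => h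
  · rintro s₁ ha₁ ⟨h12, ho, hmsg⟩
    refine Does.mono (Does.seq
      (T₂ := 1500 * ((nbrs G v).card * (nbrs G v).card) + 1500 * (nbrs G v).card + 100)
      ((does_evaluate hG h0 h1 hq hm
      (hl.agree ha₁ (by decide) (by decide)) (hc.agree ha₁ (by decide))
      (by rw [ha₁.1 11 (by decide), hv]) h12 hmsg).mono le_rfl ?_)) ?_ fun _ _ h => h
    · intro s₂ ha₂ hr
      have ho₂ : Ordered G v s₂ := by
        rw [Ordered, ha₂.1 7 (by decide)]
        exact ho
      have hf : Found G α q s → Found G α q s₂ := fun h =>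
        (h.agree ha₁ (by decide)).agree ha₂ (by decide)
      have hp : Pending s → Pending s₂ := fun h =>
        (h.agree ha₁ (by decide)).agree ha₂ (by decide)
      exact (does_rounds hG h0 h1 hq hm hr ho₂ (hfp.imp hf hp)).mono le_rfl
        fun s' _ h => ⟨fun h' => h.1 (hf h'), fun h' => h.2 (hp h')⟩
    · omega
  · omega

theorem does_testPlayers (hG : G.IsAcyclic) (h0 : 0 < α) (h1 : α < 1) (hq : IsDistribution q)
    (hm : IsMessage G (1 - α) (fun v => α * q v) a b) (hA : IsArcList G (m + m) S D)
    {s : Store} (hl : Loaded G α q m S D s) (hc : Converged G m S D a b s) (hp : Pending s) :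
    Does testPlayers s (3000 * (n * (m + m)) + n * (100 * (m + m) + 400) + 100) fun s' =>
      Found G α q s' ∨ Pending s' ∧ IsNash G α q := by
  let deg : ℕ → ℕ := fun i => if h : i < n then (nbrs G ⟨i, h⟩).card else 0
  have hdeg : ∑ i ∈ Finset.range n, deg i = m + m := by
    rw [← hA.sum_card_nbrs, Finset.sum_range]
    simp [deg]
  refine (Does.forLoop n (fun i => 3000 * (n * deg i) + 100 * (m + m) + 300)
    (fun i s' => Found G α q s' ∨ Pending s' ∧ ∀ u : Fin n, (u : ℕ) < i → IsBestResponse G α q u)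
    (by decide) ?_ ?_ ?_).mono ?_ ?_
  · intro s' h
    simp [NExpr.eval, h.1 0 (by decide), hl.size]
  · exact Or.inr ⟨hp.agree (p := .setInt 11 (.const 0) (.const 0))
      (Exec.setInt s 11 (.const 0) (.const 0)).agree (by decide), fun u hu => absurd hu (by omega)⟩
  · intro i s' hi ha hx hI
    have hset : ∀ s' : Store, Agree (.setInt 11 (.const 0) (.const (i + 1))) s'
        (s'.setInt 11 0 (i + 1)) :=
      fun s' => (Exec.setInt s' 11 (.const 0) (.const (i + 1))).agree
    refine (does_testPlayer (v := ⟨i, hi⟩) hG h0 h1 hq hm hA (hl.agree ha (by decide) (by decide))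
      (hc.agree ha (by decide)) hx (hI.imp id And.left)).mono ?_ ?_
    · have h2 : deg i = (nbrs G ⟨i, hi⟩).card := by simp [deg, hi]
      rw [← h2]
      -- The square of a degree is at most `n` times the degree, and the degrees sum to the number
      -- of arcs.
      have h3 : deg i ≤ n := by
        rw [h2]
        exact (Finset.card_le_univ _).trans_eq (Fintype.card_fin n)
      have h4 := Nat.mul_le_mul_right (deg i) h3
      have h5 := Nat.mul_le_mul_right (deg i) (by omega : 1 ≤ n)
      omega
    · rintro s'' - ⟨hf, hp⟩
      rcases hI with h | ⟨h, hbr⟩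
      · exact Or.inl ((hf h).agree (hset s'') (by simp [Prog.intWrites]))
      · refine (hp h).imp (fun h => h.agree (hset s'') (by simp [Prog.intWrites]))
          fun h => ⟨h.1.agree (hset s'') (by simp [Prog.intWrites]), fun u hu => ?_⟩
        rcases Nat.lt_succ_iff_lt_or_eq.1 hu with hu | hu
        · exact hbr u hu
        · rw [show u = ⟨i, hi⟩ from Fin.ext hu]
          exact h.2
  · simp only [Finset.sum_add_distrib, Finset.sum_const, Finset.card_range, smul_eq_mul,
      ← Finset.mul_sum, hdeg, NExpr.cost, mul_add]
    omega
  · rintro s' - h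
    exact h.imp id fun h => ⟨h.1, fun u => h.2 u u.2⟩

end Players

/-! ### The complete program and its running time. -/

/-- Decide whether a tree is a Nash equilibrium. -/
def nashTest : Prog :=
  .seq loadGraph (.seq passMessages (.seq (.setInt 3 (.const 0) (.const 1)) testPlayers))

theorem does_nashTest {n : ℕ} {G : SimpleGraph (Fin n)} {es : List (Fin n × Fin n)} {α : ℝ}
    {q : Fin n → ℝ} (hG : G.IsTree) (hes : IsEdgeList G es) (h0 : 0 < α) (h1 : α < 1)
    (hq : IsDistribution q) :
    Does nashTest (inputStore es α q) (20000 * n ^ 2) fun s =>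
      Found G α q s ∨ Pending s ∧ IsNash G α q := by
  classical
  obtain ⟨v₀⟩ := hG.connected.nonempty
  obtain ⟨S, D, hA, hS, hSD⟩ := exists_isArcList hes v₀
  obtain ⟨a, b, hm⟩ := exists_isMessage hG.isAcyclic (1 - α) fun v => α * q v
  have hn : 1 ≤ n := v₀.pos
  -- A tree has fewer edges than vertices, so the bounds in `n` and the number of arcs become
  -- quadratic in `n`.
  have hlen : es.length ≤ n := by
    have h2 := hG.card_edgeFinset
    have h3 : (es.map fun e => s(e.1, e.2)).toFinset = G.edgeFinset := by
      ext x
      rw [List.mem_toFinset, hes.2, SimpleGraph.mem_edgeFinset]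
    rw [← h3, List.toFinset_card_of_nodup hes.1, List.length_map, Fintype.card_fin] at h2
    omega
  refine Does.mono (Does.seq (T₂ := 19000 * n ^ 2)
    ((does_loadGraph (α := α) (q := q) hA hS hSD).mono le_rfl ?_)) ?_ fun _ _ h => h
  · intro s₁ ha₁ hl
    refine Does.mono (Does.seq
      (T₂ := 3000 * (n * (es.length + es.length)) +
        n * (100 * (es.length + es.length) + 400) + 110)
      ((does_passMessages hG.isAcyclic hA hSD hm hl ?_ ?_ ?_ ?_).mono
      le_rfl ?_)) ?_ fun _ _ h => h
    · rw [ha₁.2 2 (by decide)]; simp [inputStore]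
    · rw [ha₁.2 3 (by decide)]; simp [inputStore]
    · rw [ha₁.2 4 (by decide)]; simp [inputStore]
    · rw [ha₁.2 5 (by decide)]; simp [inputStore]
    · intro s₂ ha₂ hc
      refine Does.mono (Does.seq (T₁ := 10) (Does.of_run rfl (by decide)
        (does_testPlayers hG.isAcyclic h0 h1 hq hm hA
          (s := Prog.run (.setInt 3 (.const 0) (.const 1)) s₂) ?_ ?_ ?_))) ?_ fun _ _ h => h
      · exact (hl.agree ha₂ (by decide) (by decide)).agree
          (Exec.setInt s₂ 3 (.const 0) (.const 1)).agree (by decide) (by decide)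
      · exact hc.agree (Exec.setInt s₂ 3 (.const 0) (.const 1)).agree (by decide)
      · refine ⟨by simp [Prog.run, answer, NExpr.eval], ?_⟩
        simp [Prog.run, ha₂.1 4 (by decide), ha₁.1 4 (by decide), inputStore]
      · omega
    · nlinarith
  · nlinarith

end PageRankGame

theorem theorem3p1 :
    ∃ (P : RealRAM.Prog) (C : ℕ),
      ∀ (n : ℕ) (G : SimpleGraph (Fin n)) (es : List (Fin n × Fin n)) (α : ℝ) (q : Fin n → ℝ),
        G.IsTree → PageRankGame.IsEdgeList G es → 0 < α → α < 1 →
        PageRankGame.IsDistribution q →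
        ∃ (t : ℕ) (s : RealRAM.Store),
          RealRAM.Exec P (PageRankGame.inputStore es α q) t s ∧
          t ≤ C * n ^ 2 ∧
          (PageRankGame.IsNash G α q → PageRankGame.answer s = 1) ∧
          (¬ PageRankGame.IsNash G α q → PageRankGame.answer s = 0 ∧
            ∃ v : Fin n, PageRankGame.outPlayer s = v ∧
              PageRankGame.IsImproving G α q v (PageRankGame.outStrategy n s)) := by
  refine ⟨PageRankGame.nashTest, 20000, fun n G es α q hG hes h0 h1 hq => ?_⟩
  obtain ⟨t, s, hex, ht, h⟩ := PageRankGame.does_nashTest hG hes h0 h1 hq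
  refine ⟨t, s, hex, ht, fun hN => ?_, fun hN => ?_⟩
  · rcases h with ⟨-, v, -, hi⟩ | h
    · exact absurd (hN v _ hi.1) (not_le.2 hi.2)
    · exact h.1.1
  · exact h.resolve_right fun h => hN h.2
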